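/- Let $m\ge 1$ be an integer and let $\delta:\{1,2,\dots\}\to(-m,\infty)$. The preferential attachment model with parameter $\delta(\cdot)$ is the following sequence of random directed loopless multigraphs $G_1,G_2,\dots$, where $G_t$ has vertex set $\{0,\dots,t\}$. The graph $G_1$ consists of $m$ edges from $1$ to $0$. For $t\ge 2$, let $G_{t,0}$ be $G_{t-1}$ together with an isolated vertex $t$. For $i=1,\dots,m$, the graph $G_{t,i}$ is obtained from $G_{t,i-1}$ by adding one edge from $t$ to a random vertex $V_{t,i}\in\{0,\dots,t-1\}$, where, conditionally on the past, $$\mathbb P(V_{t,i}=v)=\frac{\mathsf d_{G_{t,i-1}}(v)+\delta(t)}{\sum_{v'=0}^{t-1}\big(\mathsf d_{G_{t,i-1}}(v')+\delta(t)\big)},$$ and $\mathsf d_g(v)$ is the degree of $v$ in $g$ (in-degree plus out-degree, counted with multiplicity). Finally $G_t=G_{t,m}$. Write $s(g)$ for the unlabeled graph of $g$, that is, the isomorphism class of the directed multigraph $g$. Let $\delta_0\ge 0$ and $\delta_1>-m$. For $n\ge1$ let $1\le\tau_n\le n$ be an integer and $\Delta_n=n-\tau_n$. Let $\mathbb P_0^n$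 and $\mathbb P_1^n$ be probability measures on a common measurable space on which a random labeled graph $G_n$ is defined, such that under $\mathbb P_0^n$ (hypothesis $H_0$) $G_n$ is the preferential attachment graph at time $n$ with $\delta(t)=\delta_0$ for all $t$, and under $\mathbb P_1^n$ (hypothesis $H_1$) it is the preferential attachment graph at time $n$ with $\delta(t)=\delta_0\mathbf 1_{t\le\tau_n}+\delta_1\mathbf 1_{t>\tau_n}$. Let $\mathbb E_0^n,\mathbb E_1^n$ be the corresponding expectations. Suppose that either $\delta_0>0$ and $\Delta_n=o(n^{1/3})$, or $\delta_0=0$ and $\Delta_n=o\big(n^{1/3}/\log n\big)$, as $n\to\infty$. Then the following hold. 1. The laws of $s(G_n)$ under $H_1$ are contiguous to those under $H_0$: for every sequence of events $(A_n)_{n\ge1}$ with $A_n\in\sigma(s(G_n))$ for all $n$, if $\mathbb P_0^n(A_n)\to0$ then $\mathbb P_1^n(A_n)\to0$. 2. Consequently, no test based on $s(G_n)$ can detect the change-point, even when $m$, $\delta_0$, $\delta_1$ and $\tau_n$ are known: for every sequence $(\phi_n)_{n\ge1}$ of $\sigma(s(G_n))$-measurable (possibly randomized) tests with values in $[0,1]$,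 if $\mathbb E_0^n(\phi_n)\to0$ then $\mathbb E_1^n(\phi_n)\to0$; in particular $\mathbb E_0^n(\phi_n)+\mathbb E_1^n(1-\phi_n)$ does not tend to $0$. -/

import Mathlib

open Filter Topology MeasureTheory Asymptotics
open scoped ENNReal

noncomputable section

/-- A labeled directed multigraph with vertex set `V`: a multiset of directed edges `(u, v)`
(the arrow goes from `u` to `v`), without loops. -/
@[ext]
structure LabeledGraph (V : Type*) where
  edges : Multiset (V × V)
  loopless : ∀ e ∈ edges, e.1 ≠ e.2

namespace LabeledGraph

open scoped Classical in
/-- The multiplicity `μ_g(u, v)`: the number of directed edges `u → v`. -/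
def mult {V : Type*} (g : LabeledGraph V) (u v : V) : ℕ := g.edges.count (u, v)

/-- The degree of a vertex: in-degree plus out-degree, with multiplicity. -/
def degree {V : Type*} [Fintype V] (g : LabeledGraph V) (v : V) : ℕ :=
  (∑ u, g.mult u v) + ∑ u, g.mult v u

/-- An isomorphism of labeled multigraphs is a bijection of the vertex sets that preserves the
multiplicities of the directed edges. -/
def Isomorphic {V W : Type*} (g : LabeledGraph V) (h : LabeledGraph W) : Prop :=
  ∃ φ : V ≃ W, ∀ u v, h.mult (φ u) (φ v) = g.mult u v

/-- Isomorphism as an equivalence relation on the labeled graphs with vertex set `V`. -/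
def isoSetoid (V : Type*) : Setoid (LabeledGraph V) where
  r := Isomorphic
  iseqv :=
    { refl := fun _ => ⟨Equiv.refl _, fun _ _ => rfl⟩
      symm := by
        rintro g h ⟨φ, hφ⟩
        exact ⟨φ.symm, fun u v => by simpa using (hφ (φ.symm u) (φ.symm v)).symm⟩
      trans := by
        rintro g h k ⟨φ, hφ⟩ ⟨ψ, hψ⟩
        exact ⟨φ.trans ψ, fun u v => (hψ _ _).trans (hφ u v)⟩ }

/-- Every set of labeled graphs is measurable. -/
instance (V : Type*) : MeasurableSpace (LabeledGraph V) := ⊤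

/-- Add one edge directed from `u` to `v`. -/
def addEdge {V : Type*} (g : LabeledGraph V) (u v : V) (h : u ≠ v) : LabeledGraph V where
  edges := (u, v) ::ₘ g.edges
  loopless := by
    intro e he
    rcases Multiset.mem_cons.1 he with rfl | he
    · exact h
    · exact g.loopless e he

/-- Add to a graph on `{0, …, t - 1}` an isolated vertex with label `t`. -/
def addVertex {t : ℕ} (g : LabeledGraph (Fin t)) : LabeledGraph (Fin (t + 1)) where
  edges := g.edges.map (Prod.map Fin.castSucc Fin.castSucc)
  loopless := by
    intro e he
    obtain ⟨a, ha, rfl⟩ := Multiset.mem_map.1 he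
    exact fun h => g.loopless a ha (Fin.castSucc_injective _ h)

end LabeledGraph

/-- Unlabeled graphs with vertex set of the size of `V`: isomorphism classes of labeled graphs. -/
def UnlabeledGraph (V : Type*) : Type _ := Quotient (LabeledGraph.isoSetoid V)

/-- Every set of unlabeled graphs is measurable. -/
instance (V : Type*) : MeasurableSpace (UnlabeledGraph V) := ⊤

/-- The structure `s(g)` of a labeled graph: its isomorphism class. -/
def LabeledGraph.toUnlabeled {V : Type*} (g : LabeledGraph V) : UnlabeledGraph V :=
  Quotient.mk (LabeledGraph.isoSetoid V) g

namespace PrefAttach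

/-- The probability that an edge emanating from the newest vertex `t + 1` of a graph on
`{0, …, t + 1}` is attached to the older vertex `v ∈ {0, …, t}`, with affine parameter `d`:
`(deg v + d) / ∑_{v' ≤ t} (deg v' + d)`. -/
def attachProb (d : ℝ) {t : ℕ} (g : LabeledGraph (Fin (t + 2))) (v : Fin (t + 1)) : ℝ :=
  ((g.degree v.castSucc : ℝ) + d) / ∑ v' : Fin (t + 1), ((g.degree v'.castSucc : ℝ) + d)

/-- These numbers form a probability vector whenever all the weights are positive. -/
theorem sum_attachProb (d : ℝ) {t : ℕ} (g : LabeledGraph (Fin (t + 2)))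
    (h : ∀ v : Fin (t + 1), 0 < (g.degree v.castSucc : ℝ) + d) :
    ∑ v, ENNReal.ofReal (attachProb d g v) = 1 := by
  have hpos : 0 < ∑ v' : Fin (t + 1), ((g.degree v'.castSucc : ℝ) + d) :=
    Finset.sum_pos (fun v _ => h v) Finset.univ_nonempty
  have hnn : ∀ v ∈ Finset.univ, 0 ≤ attachProb d g v :=
    fun v _ => div_nonneg (h v).le hpos.le
  rw [← ENNReal.ofReal_sum_of_nonneg hnn]
  simp only [attachProb]
  rw [← Finset.sum_div, div_self hpos.ne', ENNReal.ofReal_one]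

open scoped Classical in
/-- The law of the endpoint of one new edge, given the current graph. The second branch is never
reached in the model, where all the older vertices have degree at least `m` and `d > -m`. -/
def attachPMF (d : ℝ) {t : ℕ} (g : LabeledGraph (Fin (t + 2))) : PMF (Fin (t + 1)) :=
  if h : ∑ v, ENNReal.ofReal (attachProb d g v) = 1 then
    PMF.ofFintype (fun v => ENNReal.ofReal (attachProb d g v)) h
  else PMF.uniformOfFintype (Fin (t + 1))

/-- The law of the graph obtained from a graph on `{0, …, t + 1}` by adding successively `k` edges
from the newest vertex `t + 1` to random older vertices; the degrees are updated after each
edge. -/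
def addEdgesPMF (d : ℝ) {t : ℕ} (g : LabeledGraph (Fin (t + 2))) :
    ℕ → PMF (LabeledGraph (Fin (t + 2)))
  | 0 => PMF.pure g
  | k + 1 => (addEdgesPMF d g k).bind fun g' =>
      (attachPMF d g').map fun v =>
        g'.addEdge (Fin.last (t + 1)) v.castSucc (Fin.castSucc_lt_last v).ne'

/-- The graph `G_1`: two vertices `0` and `1`, and `m` edges from `1` to `0`. -/
def initialGraph (m : ℕ) : LabeledGraph (Fin 2) where
  edges := Multiset.replicate m (1, 0)
  loopless := by
    intro e he
    rw [Multiset.eq_of_mem_replicate he]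
    decide

/-- The law of the preferential attachment graph `G_n` on `{0, …, n}` with `m` edges per vertex and
affine parameter `δ t` at time `t` (the model starts at `n = 1`; the value at `n = 0` plays
no role). -/
def law (m : ℕ) (δ : ℕ → ℝ) : (n : ℕ) → PMF (LabeledGraph (Fin (n + 1)))
  | 0 => PMF.pure ⟨0, by simp⟩
  | 1 => PMF.pure (initialGraph m)
  | n + 2 => (law m δ (n + 1)).bind fun g => addEdgesPMF (δ (n + 2)) g.addVertex m

/-- The attachment parameter with a change-point at `τ`: `δ₀` up to time `τ` and `δ₁` after. -/
def changePoint (δ₀ δ₁ : ℝ) (τ : ℕ) (t : ℕ) : ℝ := if t ≤ τ then δ₀ else δ₁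

/-- The `σ`-field `σ(s(G))` generated by the unlabeled version of a random labeled graph `G`. -/
abbrev sigmaUnlabeled {Ω V : Type*} (G : Ω → LabeledGraph V) : MeasurableSpace Ω :=
  MeasurableSpace.comap (fun ω => (G ω).toUnlabeled) inferInstance

end PrefAttach

end

/-! Write `K` and `K'` for the Markov operators that add one vertex with parameter `δ₀` and `δ₁`,
and `D` for the number of late vertices. For a test function `f` of the unlabeled graph, the
expectation under `H₁` is `K ^ (a + D²) (K' ^ D f)` at the initial state, and under `H₀` it is `K ^
(a + D² + D) f`. The operators act on functions, so the leftmost factor is the earliest step.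

The late steps are hidden by moving them to random earlier times. Near time `t`, the `2m` edges of
two consecutive vertices change the normalized weights by `O(1/t)`. With the weights frozen the two
vertices act independently, and exchanging their labels is invisible to `f`. Hence `K` and `K'`
commute on functions of the unlabeled graph up to `O(1/t)` (`abs_vertexStep_commutator_le`). Moving
the `D` modified steps so that each occupies a uniform position in its own block of length `D + 1`
takes at most `D³` transpositions and costs `O(D³ / a)` (`abs_insertionAverage_pow_sub_le`).

The resulting mixture is compared with `K` in mean square. One modified step at a uniform position
among `L` steps has second moment at most `1 + B / L`, where `B` bounds the density of `K'` with
respect to `K`; this is a martingale variance computation (`sq_insertionAverage_le`). Over `D`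
blocks of length `D + 1` the factor stays below `exp B`, so Cauchy–Schwarz bounds the mixture's
expectation of `f` by `√(exp B * K ^ n f)`. Since `a` is of order `n`, both terms vanish when `D =
o(n^{1/3})` and the `H₀`-expectation tends to zero (`exists_comparison_bound`). Both regimes of the
theorem give this rate. Tests reduce to events by Markov's inequality. -/

noncomputable section

/-! ### Markov operators: monotonicity and Jensen. -/

/-- A linear operator on real functions that is positive and preserves constants, where its values
on `S` depend only on the values of the function on `S'`: a Markov kernel from `S` to `S'`. -/
structure IsMarkovOn {X : Type*} (S S' : Set X) (K : Module.End ℝ (X → ℝ)) : Prop where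
  nonneg : ∀ f : X → ℝ, (∀ x ∈ S', 0 ≤ f x) → ∀ x ∈ S, 0 ≤ K f x
  one : ∀ x ∈ S, K 1 x = 1

namespace IsMarkovOn

variable {X : Type*} {S S' S'' : Set X} {K K' : Module.End ℝ (X → ℝ)}

theorem mono (h : IsMarkovOn S S' K) {f g : X → ℝ} (hfg : ∀ x ∈ S', f x ≤ g x) {x : X}
    (hx : x ∈ S) : K f x ≤ K g x := by
  have := h.nonneg (g - f) (fun y hy => sub_nonneg.2 (hfg y hy)) x hx
  rw [map_sub, Pi.sub_apply] at this
  linarith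

theorem const (h : IsMarkovOn S S' K) (c : ℝ) {x : X} (hx : x ∈ S) : K (fun _ => c) x = c := by
  have : (fun _ : X => c) = c • (1 : X → ℝ) := by ext; simp
  rw [this, map_smul, Pi.smul_apply, h.one x hx, smul_eq_mul, mul_one]

theorem le_const (h : IsMarkovOn S S' K) {f : X → ℝ} {c : ℝ} (hf : ∀ x ∈ S', f x ≤ c) {x : X}
    (hx : x ∈ S) : K f x ≤ c :=
  (h.mono hf hx).trans_eq (h.const c hx)

theorem const_le (h : IsMarkovOn S S' K) {f : X → ℝ} {c : ℝ} (hf : ∀ x ∈ S', c ≤ f x) {x : X}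
    (hx : x ∈ S) : c ≤ K f x :=
  (h.const c hx).symm.trans_le (h.mono hf hx)

theorem abs_sub_le (h : IsMarkovOn S S' K) {f g : X → ℝ} {c : ℝ}
    (hfg : ∀ x ∈ S', |f x - g x| ≤ c) {x : X} (hx : x ∈ S) : |K f x - K g x| ≤ c := by
  have e : K f x - K g x = K (f - g) x := by rw [map_sub, Pi.sub_apply]
  rw [e, abs_le]
  exact ⟨h.const_le (fun y hy => (abs_le.1 (hfg y hy)).1) hx,
    h.le_const (fun y hy => (abs_le.1 (hfg y hy)).2) hx⟩

theorem apply_sub_const_sq (h : IsMarkovOn S S' K) (f : X → ℝ) (c : ℝ) {x : X} (hx : x ∈ S) :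
    K ((f - fun _ => c) ^ 2) x = K (f ^ 2) x - 2 * c * K f x + c ^ 2 := by
  have : (f - fun _ => c) ^ 2 = f ^ 2 - (2 * c) • f + fun _ => c ^ 2 := by
    ext y; simp; ring
  rw [this, map_add, map_sub, map_smul, Pi.add_apply, Pi.sub_apply, Pi.smul_apply,
    h.const _ hx, smul_eq_mul]

/-- The variance of `f` under the kernel is nonnegative. -/
theorem sq_le (h : IsMarkovOn S S' K) (f : X → ℝ) {x : X} (hx : x ∈ S) :
    K f x ^ 2 ≤ K (f ^ 2) x := by
  have := h.nonneg ((f - fun _ => K f x) ^ 2) (fun y _ => sq_nonneg _) x hx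
  rw [h.apply_sub_const_sq f _ hx] at this
  linarith

theorem mono_target (h : IsMarkovOn S S' K) (hS : S' ⊆ S'') : IsMarkovOn S S'' K :=
  ⟨fun f hf x hx => h.nonneg f (fun y hy => hf y (hS hy)) x hx, h.one⟩

theorem id (S : Set X) : IsMarkovOn S S (1 : Module.End ℝ (X → ℝ)) :=
  ⟨fun _ hf x hx => hf x hx, fun _ _ => rfl⟩

theorem mul (h : IsMarkovOn S S' K) (h' : IsMarkovOn S' S'' K') : IsMarkovOn S S'' (K * K') where
  nonneg f hf x hx := h.nonneg _ (h'.nonneg f hf) x hx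
  one x hx := by
    refine le_antisymm (h.le_const (fun y hy => (h'.one y hy).le) hx)
      (h.const_le (fun y hy => (h'.one y hy).ge) hx)

theorem pow (h : IsMarkovOn S S K) (n : ℕ) : IsMarkovOn S S (K ^ n) := by
  induction n with
  | zero => exact IsMarkovOn.id S
  | succ n ih => rw [pow_succ]; exact ih.mul h

theorem pow_family {S : ℕ → Set X} (h : ∀ t, IsMarkovOn (S t) (S (t + 1)) K) (t n : ℕ) :
    IsMarkovOn (S t) (S (t + n)) (K ^ n) := by
  induction n with
  | zero => exact IsMarkovOn.id _
  | succ n ih => rw [pow_succ]; exact ih.mul (h _)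

end IsMarkovOn

/-! ### Abstract mixing: one modified step at a random position in each block. -/

section Mixing

variable {X : Type*} {S : Set X} {K₀ K₁ : Module.End ℝ (X → ℝ)}

/-- The sum over the `k` possible positions of one step with `K₁` among `k` steps, the other steps
being made with `K₀`. -/
def insertionSum (K₀ K₁ : Module.End ℝ (X → ℝ)) : ℕ → Module.End ℝ (X → ℝ)
  | 0 => 0
  | k + 1 => K₁ * K₀ ^ k + K₀ * insertionSum K₀ K₁ k

/-- With `c = K₀ f x`, the difference is `K₁ (f - c) x`. Jensen for `K₁` and then domination turn
its square into `B` times a variance under `K₀`. -/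
theorem sq_sub_le_of_dominated (h₀ : IsMarkovOn S S K₀) (h₁ : IsMarkovOn S S K₁) {B : ℝ}
    (hdom : ∀ f : X → ℝ, (∀ x ∈ S, 0 ≤ f x) → ∀ x ∈ S, K₁ f x ≤ B * K₀ f x)
    (f : X → ℝ) {x : X} (hx : x ∈ S) :
    (K₁ f x - K₀ f x) ^ 2 ≤ B * (K₀ (f ^ 2) x - K₀ f x ^ 2) := by
  have h2 := h₁.sq_le (f - fun _ => K₀ f x) hx
  have h3 := hdom ((f - fun _ => K₀ f x) ^ 2) (fun y _ => sq_nonneg _) x hx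
  rw [h₀.apply_sub_const_sq f _ hx] at h3
  rw [map_sub, Pi.sub_apply, h₁.const _ hx] at h2
  calc _ ≤ _ := h2
    _ ≤ _ := h3
    _ = _ := by ring

/-- Cauchy–Schwarz with weights `k` and `1`. The exact factor `k + 1` lets the induction over the
number of steps close without loss. -/
theorem add_sq_le_of_sq_le {x y s v B k : ℝ} (hk : 0 ≤ k) (hB : 0 ≤ B) (hs : 0 ≤ s) (hv : 0 ≤ v)
    (hx : x ^ 2 ≤ k * B * s) (hy : y ^ 2 ≤ B * v) : (x + y) ^ 2 ≤ (k + 1) * B * (s + v) := by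
  have h1 : (2 * (x * y)) ^ 2 ≤ (B * (k * v + s)) ^ 2 := by
    calc (2 * (x * y)) ^ 2 = 4 * (x ^ 2 * y ^ 2) := by ring
      _ ≤ 4 * ((k * B * s) * (B * v)) := by gcongr
      _ ≤ (B * (k * v + s)) ^ 2 := by nlinarith [mul_nonneg (sq_nonneg B) (sq_nonneg (k * v - s))]
  have h2 := abs_le_of_sq_le_sq h1 (by positivity)
  nlinarith [le_of_abs_le h2]

/-- Replacing `K₀` by `K₁` at one step is charged to the variance produced at that step. By the law
of total variance these contributions add up to the variance over `k` steps, so the bound grows like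
`k` and not like `k ^ 2`; dividing by `k ^ 2` then leaves `B / k`. -/
theorem sq_insertionSum_sub_le (h₀ : IsMarkovOn S S K₀) (h₁ : IsMarkovOn S S K₁) {B : ℝ}
    (hB : 0 ≤ B) (hdom : ∀ f : X → ℝ, (∀ x ∈ S, 0 ≤ f x) → ∀ x ∈ S, K₁ f x ≤ B * K₀ f x)
    (f : X → ℝ) (k : ℕ) : ∀ x ∈ S,
    (insertionSum K₀ K₁ k f x - k * (K₀ ^ k) f x) ^ 2 ≤
      k * B * ((K₀ ^ k) (f ^ 2) x - (K₀ ^ k) f x ^ 2) := by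
  induction k with
  | zero => intro x _; simp [insertionSum]
  | succ k ih =>
    intro x hx
    set g := (K₀ ^ k) f with hg
    set q := (K₀ ^ k) (f ^ 2) with hq
    set Y := insertionSum K₀ K₁ k f - (k : ℝ) • g with hY
    have e1 : (K₀ ^ (k + 1)) f = K₀ g := by rw [pow_succ']; rfl
    have e2 : (K₀ ^ (k + 1)) (f ^ 2) = K₀ q := by rw [pow_succ']; rfl
    have e3 : insertionSum K₀ K₁ (k + 1) f x - (k + 1 : ℕ) * (K₀ ^ (k + 1)) f x
        = K₀ Y x + (K₁ g x - K₀ g x) := by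
      have : insertionSum K₀ K₁ (k + 1) f = K₁ g + K₀ (insertionSum K₀ K₁ k f) := rfl
      rw [e1, this, hY, map_sub, map_smul, Pi.add_apply, Pi.sub_apply, Pi.smul_apply, smul_eq_mul]
      push_cast; ring
    have hvar : ∀ y ∈ S, 0 ≤ q y - g y ^ 2 := fun y hy => sub_nonneg.2 ((h₀.pow k).sq_le f hy)
    have hKvar : K₀ (q - g ^ 2) x = K₀ q x - K₀ (g ^ 2) x := by rw [map_sub, Pi.sub_apply]
    have hYle : K₀ Y x ^ 2 ≤ k * B * (K₀ q x - K₀ (g ^ 2) x) := by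
      refine (h₀.sq_le Y hx).trans ?_
      refine (h₀.mono (g := (k * B) • (q - g ^ 2)) (fun y hy => ih y hy) hx).trans_eq ?_
      rw [map_smul, Pi.smul_apply, hKvar, smul_eq_mul]
    have h5 := h₀.nonneg (q - g ^ 2) hvar x hx
    rw [hKvar] at h5
    have := add_sq_le_of_sq_le (Nat.cast_nonneg k) hB h5 (sub_nonneg.2 (h₀.sq_le g hx)) hYle
      (sq_sub_le_of_dominated h₀ h₁ hdom g hx)
    rw [e3, e1, e2]
    refine this.trans_eq ?_
    push_cast; ring

/-- The average over the position of one step with `K₁` among `l + 1` steps. -/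
def insertionAverage (K₀ K₁ : Module.End ℝ (X → ℝ)) (l : ℕ) : Module.End ℝ (X → ℝ) :=
  ((l : ℝ) + 1)⁻¹ • insertionSum K₀ K₁ (l + 1)

theorem insertionSum_nonneg (h₀ : IsMarkovOn S S K₀) (h₁ : IsMarkovOn S S K₁) (k : ℕ)
    (f : X → ℝ) (hf : ∀ x ∈ S, 0 ≤ f x) : ∀ x ∈ S, 0 ≤ insertionSum K₀ K₁ k f x := by
  induction k with
  | zero => intro x _; simp [insertionSum]
  | succ k ih =>
    intro x hx
    exact add_nonneg ((h₁.mul (h₀.pow k)).nonneg f hf x hx) (h₀.nonneg _ ih x hx)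

theorem insertionSum_one (h₀ : IsMarkovOn S S K₀) (h₁ : IsMarkovOn S S K₁) (k : ℕ) :
    ∀ x ∈ S, insertionSum K₀ K₁ k 1 x = k := by
  induction k with
  | zero => intro x _; simp [insertionSum]
  | succ k ih =>
    intro x hx
    have e : insertionSum K₀ K₁ (k + 1) 1 x
        = (K₁ * K₀ ^ k) 1 x + K₀ (insertionSum K₀ K₁ k 1) x := rfl
    have h2 : K₀ (insertionSum K₀ K₁ k 1) x = k :=
      le_antisymm (h₀.le_const (fun y hy => (ih y hy).le) hx)
        (h₀.const_le (fun y hy => (ih y hy).ge) hx)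
    rw [e, (h₁.mul (h₀.pow k)).one x hx, h2]
    push_cast; ring

theorem isMarkovOn_insertionAverage (h₀ : IsMarkovOn S S K₀) (h₁ : IsMarkovOn S S K₁) (l : ℕ) :
    IsMarkovOn S S (insertionAverage K₀ K₁ l) where
  nonneg f hf x hx :=
    mul_nonneg (by positivity) (insertionSum_nonneg h₀ h₁ (l + 1) f hf x hx)
  one x hx := by
    have : insertionAverage K₀ K₁ l 1 x = ((l : ℝ) + 1)⁻¹ * insertionSum K₀ K₁ (l + 1) 1 x := rfl
    rw [this, insertionSum_one h₀ h₁ _ x hx]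
    push_cast
    exact inv_mul_cancel₀ (by positivity)

theorem sq_insertionAverage_le (h₀ : IsMarkovOn S S K₀) (h₁ : IsMarkovOn S S K₁) {B : ℝ}
    (hB : 0 ≤ B) (hdom : ∀ f : X → ℝ, (∀ x ∈ S, 0 ≤ f x) → ∀ x ∈ S, K₁ f x ≤ B * K₀ f x)
    (f : X → ℝ) (l : ℕ) {x : X} (hx : x ∈ S) :
    insertionAverage K₀ K₁ l f x ^ 2 ≤ (1 + B / (l + 1)) * (K₀ ^ (l + 1)) (f ^ 2) x := by
  have key := sq_insertionSum_sub_le h₀ h₁ hB hdom f (l + 1) x hx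
  have e : insertionAverage K₀ K₁ l f x = ((l : ℝ) + 1)⁻¹ * insertionSum K₀ K₁ (l + 1) f x := rfl
  have hV := (h₀.pow (l + 1)).sq_le f hx
  set L : ℝ := (l : ℝ) + 1 with hL
  have hLpos : 0 < L := by positivity
  have hcast : ((l + 1 : ℕ) : ℝ) = L := by push_cast; rfl
  rw [hcast] at key
  rw [e]
  set u := insertionSum K₀ K₁ (l + 1) f x
  set a := (K₀ ^ (l + 1)) f x
  set q := (K₀ ^ (l + 1)) (f ^ 2) x
  have h3 : (L⁻¹ * u - a) ^ 2 ≤ B / L * (q - a ^ 2) := by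
    have : (L⁻¹ * u - a) ^ 2 = L⁻¹ ^ 2 * (u - L * a) ^ 2 := by field_simp
    rw [this]
    calc _ ≤ L⁻¹ ^ 2 * (L * B * (q - a ^ 2)) := by gcongr
      _ = _ := by field_simp
  -- The mean `a` is put back: deviation and mean are combined with weights `B / L` and `1`, and the
  -- variance plus `a ^ 2` is the second moment `q`.
  have h4 := add_sq_le_of_sq_le (x := L⁻¹ * u - a) (y := a) (s := q - a ^ 2) (v := a ^ 2)
    (B := 1) (k := B / L) (by positivity) zero_le_one (by linarith) (sq_nonneg a)
    (by simpa using h3) (by simp)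
  calc _ = (L⁻¹ * u - a + a) ^ 2 := by ring
    _ ≤ _ := h4
    _ = _ := by ring

theorem sq_insertionAverage_pow_le (h₀ : IsMarkovOn S S K₀) (h₁ : IsMarkovOn S S K₁) {B : ℝ}
    (hB : 0 ≤ B) (hdom : ∀ f : X → ℝ, (∀ x ∈ S, 0 ≤ f x) → ∀ x ∈ S, K₁ f x ≤ B * K₀ f x)
    (f : X → ℝ) (l j : ℕ) : ∀ x ∈ S,
    (insertionAverage K₀ K₁ l ^ j) f x ^ 2 ≤
      (1 + B / (l + 1)) ^ j * (K₀ ^ (j * (l + 1))) (f ^ 2) x := by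
  induction j with
  | zero => intro x _; simp
  | succ j ih =>
    intro x hx
    set c : ℝ := 1 + B / (l + 1) with hc
    have hc0 : 0 ≤ c := by positivity
    set g := (insertionAverage K₀ K₁ l ^ j) f with hg
    have e : (insertionAverage K₀ K₁ l ^ (j + 1)) f = insertionAverage K₀ K₁ l g := by
      rw [pow_succ']; rfl
    rw [e]
    refine (sq_insertionAverage_le h₀ h₁ hB hdom g l hx).trans ?_
    have e2 : (K₀ ^ ((j + 1) * (l + 1))) (f ^ 2)
        = (K₀ ^ (l + 1)) ((K₀ ^ (j * (l + 1))) (f ^ 2)) := by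
      rw [← Module.End.mul_apply, ← pow_add]; congr 2; ring
    have h3 := (h₀.pow (l + 1)).mono
      (g := c ^ j • (K₀ ^ (j * (l + 1))) (f ^ 2)) (f := g ^ 2) (fun y hy => ih y hy) hx
    rw [map_smul, Pi.smul_apply, smul_eq_mul] at h3
    rw [e2, pow_succ' c]
    calc _ ≤ c * (c ^ j * (K₀ ^ (l + 1)) ((K₀ ^ (j * (l + 1))) (f ^ 2)) x) := by gcongr
      _ = _ := by ring

variable {I : Set (X → ℝ)} {ε : ℝ}

theorem pow_mem_of_invariant {K : Module.End ℝ (X → ℝ)} (hK : ∀ f ∈ I, K f ∈ I) {f : X → ℝ}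
    (hf : f ∈ I) (k : ℕ) : (K ^ k) f ∈ I := by
  induction k with
  | zero => exact hf
  | succ k ih => rw [pow_succ']; exact hK _ ih

/-- Each transposition costs `ε`. The commutator bound is available only on the class `I`, hence the
need for `I` to be invariant. -/
theorem abs_commutator_pow_le (h₀ : IsMarkovOn S S K₀) (hI₀ : ∀ f ∈ I, K₀ f ∈ I)
    (hcomm : ∀ f ∈ I, ∀ x ∈ S, |K₁ (K₀ f) x - K₀ (K₁ f) x| ≤ ε) {f : X → ℝ} (hf : f ∈ I) (k : ℕ) :
    ∀ x ∈ S, |K₁ ((K₀ ^ k) f) x - (K₀ ^ k) (K₁ f) x| ≤ k * ε := by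
  induction k with
  | zero => intro x _; simp
  | succ k ih =>
    intro x hx
    have h1 := hcomm _ (pow_mem_of_invariant hI₀ hf k) x hx
    have h2 := h₀.abs_sub_le ih hx
    rw [pow_succ']
    refine (abs_sub_le _ (K₀ (K₁ ((K₀ ^ k) f)) x) _).trans ((add_le_add h1 h2).trans_eq ?_)
    push_cast; ring

/-- All `k + 1` terms are compared with the same word, in which `K₁` comes last. Each of them passes
at most `k + p` steps, including the `p` steps after its block. -/
theorem abs_insertionSum_sub_le (hε : 0 ≤ ε) (h₀ : IsMarkovOn S S K₀) (hI₀ : ∀ f ∈ I, K₀ f ∈ I)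
    (hcomm : ∀ f ∈ I, ∀ x ∈ S, |K₁ (K₀ f) x - K₀ (K₁ f) x| ≤ ε) {f : X → ℝ} (hf : f ∈ I)
    (p k : ℕ) : ∀ x ∈ S,
    |insertionSum K₀ K₁ (k + 1) ((K₀ ^ p) f) x - (k + 1) * (K₀ ^ (k + p)) (K₁ f) x| ≤
      (k + 1) * ((k + p) * ε) := by
  have hfirst : ∀ j : ℕ, ∀ x ∈ S,
      |(K₁ * K₀ ^ j) ((K₀ ^ p) f) x - (K₀ ^ (j + p)) (K₁ f) x| ≤ (j + p) * ε := by
    intro j x hx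
    have := abs_commutator_pow_le h₀ hI₀ hcomm hf (j + p) x hx
    rw [Module.End.mul_apply, ← Module.End.mul_apply (K₀ ^ j), ← pow_add]
    exact_mod_cast this
  induction k with
  | zero =>
    intro x hx
    have := hfirst 0 x hx
    simpa [insertionSum] using this
  | succ k ih =>
    intro x hx
    have h1 := hfirst (k + 1) x hx
    have h2 := h₀.abs_sub_le (g := ((k : ℝ) + 1) • (K₀ ^ (k + p)) (K₁ f)) ih hx
    rw [map_smul, Pi.smul_apply, smul_eq_mul] at h2
    have e : (K₀ ^ (k + 1 + p)) (K₁ f) x = K₀ ((K₀ ^ (k + p)) (K₁ f)) x := by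
      rw [show k + 1 + p = k + p + 1 by ring, pow_succ']; rfl
    have e2 : insertionSum K₀ K₁ (k + 1 + 1) ((K₀ ^ p) f) x
        = (K₁ * K₀ ^ (k + 1)) ((K₀ ^ p) f) x
          + K₀ (insertionSum K₀ K₁ (k + 1) ((K₀ ^ p) f)) x := rfl
    rw [e] at h1 ⊢
    rw [e2]
    push_cast at h1 ⊢
    rw [abs_le] at h1 h2 ⊢
    constructor <;> nlinarith [h1.1, h1.2, h2.1, h2.2, mul_nonneg (Nat.cast_nonneg (α := ℝ) k) hε]

/-- Moving the steps with `K₁` from the end to random positions costs a total error controlled by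
the number of transpositions of adjacent steps. -/
theorem abs_insertionAverage_pow_sub_le (hε : 0 ≤ ε) (h₀ : IsMarkovOn S S K₀)
    (h₁ : IsMarkovOn S S K₁) (hI₀ : ∀ f ∈ I, K₀ f ∈ I) (hI₁ : ∀ f ∈ I, K₁ f ∈ I)
    (hcomm : ∀ f ∈ I, ∀ x ∈ S, |K₁ (K₀ f) x - K₀ (K₁ f) x| ≤ ε) {f : X → ℝ} (hf : f ∈ I)
    (l j : ℕ) : ∀ x ∈ S,
    |(insertionAverage K₀ K₁ l ^ j) f x - (K₀ ^ (j * l)) ((K₁ ^ j) f) x| ≤ j ^ 2 * l * ε := by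
  induction j with
  | zero => intro x _; simp
  | succ j ih =>
    intro x hx
    have hM := isMarkovOn_insertionAverage h₀ h₁ l
    have h1 := hM.abs_sub_le ih hx
    set h := (K₁ ^ j) f with hh
    -- The other `j` modified steps are already at the end, inside `h`, so this one crosses only
    -- `K₀` steps: those of its own block and the `j * l` steps of the later blocks.
    have h2 := abs_insertionSum_sub_le hε h₀ hI₀ hcomm (pow_mem_of_invariant hI₁ hf j)
      (j * l) l x hx
    rw [← hh] at h2
    have hLpos : (0 : ℝ) < l + 1 := by positivity
    have h3 : |insertionAverage K₀ K₁ l ((K₀ ^ (j * l)) h) x - (K₀ ^ (l + j * l)) (K₁ h) x|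
        ≤ (l + (j * l : ℕ)) * ε := by
      have e : insertionAverage K₀ K₁ l ((K₀ ^ (j * l)) h) x
          = ((l : ℝ) + 1)⁻¹ * insertionSum K₀ K₁ (l + 1) ((K₀ ^ (j * l)) h) x := rfl
      have e2 : insertionAverage K₀ K₁ l ((K₀ ^ (j * l)) h) x - (K₀ ^ (l + j * l)) (K₁ h) x
          = ((l : ℝ) + 1)⁻¹ * (insertionSum K₀ K₁ (l + 1) ((K₀ ^ (j * l)) h) x
            - (l + 1) * (K₀ ^ (l + j * l)) (K₁ h) x) := by rw [e]; field_simp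
      rw [e2, abs_mul, abs_of_pos (by positivity)]
      calc _ ≤ ((l : ℝ) + 1)⁻¹ * ((l + 1) * ((l + (j * l : ℕ)) * ε)) := by gcongr
        _ = _ := by field_simp
    have e3 : (K₀ ^ ((j + 1) * l)) ((K₁ ^ (j + 1)) f) x = (K₀ ^ (l + j * l)) (K₁ h) x := by
      rw [show (j + 1) * l = l + j * l by ring, pow_succ' K₁]; rfl
    have e4 : (insertionAverage K₀ K₁ l ^ (j + 1)) f x
        = insertionAverage K₀ K₁ l ((insertionAverage K₀ K₁ l ^ j) f) x := by
      rw [pow_succ']; rfl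
    rw [e3, e4]
    refine (abs_sub_le _ _ _).trans ((add_le_add h1 h3).trans ?_)
    push_cast
    have : 0 ≤ (l : ℝ) * ε := by positivity
    have : 0 ≤ (j : ℝ) * (l * ε) := by positivity
    nlinarith

end Mixing

/-! ### The model as operators on pairs of a time and a multiset of edges. -/

namespace PrefAttach

/-- The degree of `v` in a multiset of directed edges between natural numbers. -/
def edgeDegree (e : Multiset (ℕ × ℕ)) (v : ℕ) : ℕ :=
  (e.map Prod.fst).count v + (e.map Prod.snd).count v

/-- The attachment weight of `v`, with degrees below `m` replaced by `m`. -/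
def weight (m : ℕ) (d : ℝ) (e : Multiset (ℕ × ℕ)) (v : ℕ) : ℝ := (max (edgeDegree e v) m : ℕ) + d

/-- The normalized weights of the vertices `0, …, s - 1`. -/
def weightProb (m : ℕ) (d : ℝ) (s : ℕ) (e : Multiset (ℕ × ℕ)) (v : ℕ) : ℝ :=
  weight m d e v / ∑ u ∈ Finset.range s, weight m d e u

/-- Add one edge from `a` to a vertex in `{0, …, s - 1}` chosen according to the weights in the
fixed graph `e₀`. -/
def frozenStep (m : ℕ) (d : ℝ) (s : ℕ) (e₀ : Multiset (ℕ × ℕ)) (a : ℕ) :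
    Module.End ℝ (Multiset (ℕ × ℕ) → ℝ) where
  toFun f e := ∑ v ∈ Finset.range s, weightProb m d s e₀ v * f ((a, v) ::ₘ e)
  map_add' f g := by
    ext e; simp [mul_add, Finset.sum_add_distrib]
  map_smul' c f := by
    ext e; simp only [Pi.smul_apply, smul_eq_mul, RingHom.id_apply, Finset.mul_sum]
    exact Finset.sum_congr rfl fun v _ => by ring

/-- Add one edge from `a` to a vertex in `{0, …, s - 1}` chosen according to the weights in the
current graph. -/
def edgeStep (m : ℕ) (d : ℝ) (s a : ℕ) : Module.End ℝ (Multiset (ℕ × ℕ) → ℝ) where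
  toFun f e := frozenStep m d s e a f e
  map_add' f g := by ext e; simp
  map_smul' c f := by ext e; simp

/-- One step of the model: the state consists of the time `t` and of the edges of a graph on
`{0, …, t}`, and `m` edges are added from the new vertex `t + 1`. -/
def vertexStep (m : ℕ) (d : ℝ) : Module.End ℝ (ℕ × Multiset (ℕ × ℕ) → ℝ) where
  toFun f x := (edgeStep m d (x.1 + 1) (x.1 + 1) ^ m) (fun e => f (x.1 + 1, e)) x.2
  map_add' f g := by
    ext x
    exact congrFun (map_add (edgeStep m d (x.1 + 1) (x.1 + 1) ^ m)
      (fun e => f (x.1 + 1, e)) (fun e => g (x.1 + 1, e))) x.2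
  map_smul' c f := by
    ext x
    exact congrFun (map_smul (edgeStep m d (x.1 + 1) (x.1 + 1) ^ m) c
      (fun e => f (x.1 + 1, e))) x.2

variable {m : ℕ} {d d' : ℝ}

theorem frozenStep_apply (s : ℕ) (e₀ : Multiset (ℕ × ℕ)) (a : ℕ) (f : Multiset (ℕ × ℕ) → ℝ)
    (e : Multiset (ℕ × ℕ)) : frozenStep m d s e₀ a f e =
      ∑ v ∈ Finset.range s, weightProb m d s e₀ v * f ((a, v) ::ₘ e) := rfl

theorem edgeStep_apply (s a : ℕ) (f : Multiset (ℕ × ℕ) → ℝ) (e : Multiset (ℕ × ℕ)) :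
    edgeStep m d s a f e =
      ∑ v ∈ Finset.range s, weightProb m d s e v * f ((a, v) ::ₘ e) := rfl

theorem vertexStep_apply (f : ℕ × Multiset (ℕ × ℕ) → ℝ) (x : ℕ × Multiset (ℕ × ℕ)) :
    vertexStep m d f x =
      (edgeStep m d (x.1 + 1) (x.1 + 1) ^ m) (fun e => f (x.1 + 1, e)) x.2 := rfl

/-- The truncation at `m` makes all weights positive on arbitrary multisets, so no degree condition
has to be carried through the operator estimates. On graphs of the model it has no effect, by
`le_edgeDegree_of_mem_support_law`. -/
theorem le_weight (m : ℕ) (d : ℝ) (e : Multiset (ℕ × ℕ)) (v : ℕ) : (m : ℝ) + d ≤ weight m d e v := by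
  unfold weight
  gcongr
  exact le_max_right _ _

theorem weight_pos (hd : -(m : ℝ) < d) (e : Multiset (ℕ × ℕ)) (v : ℕ) : 0 < weight m d e v :=
  lt_of_lt_of_le (by linarith) (le_weight m d e v)

theorem le_sum_weight (m : ℕ) (d : ℝ) (e : Multiset (ℕ × ℕ)) (s : ℕ) :
    s * ((m : ℝ) + d) ≤ ∑ u ∈ Finset.range s, weight m d e u := by
  have := Finset.card_nsmul_le_sum (Finset.range s) (weight m d e) _
    (fun v _ => le_weight m d e v)
  rwa [Finset.card_range, nsmul_eq_mul] at this

theorem sum_weight_pos (hd : -(m : ℝ) < d) (e : Multiset (ℕ × ℕ)) {s : ℕ} (hs : 0 < s) :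
    0 < ∑ u ∈ Finset.range s, weight m d e u :=
  Finset.sum_pos (fun v _ => weight_pos hd e v) ⟨0, Finset.mem_range.2 hs⟩

theorem weightProb_nonneg (hd : -(m : ℝ) < d) (s : ℕ) (e : Multiset (ℕ × ℕ)) (v : ℕ) :
    0 ≤ weightProb m d s e v :=
  div_nonneg (weight_pos hd e v).le (Finset.sum_nonneg fun u _ => (weight_pos hd e u).le)

theorem sum_weightProb (hd : -(m : ℝ) < d) {s : ℕ} (hs : 0 < s) (e : Multiset (ℕ × ℕ)) :
    ∑ v ∈ Finset.range s, weightProb m d s e v = 1 := by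
  simp only [weightProb]
  rw [← Finset.sum_div, div_self (sum_weight_pos hd e hs).ne']

theorem isMarkovOn_frozenStep (hd : -(m : ℝ) < d) {s a : ℕ} (hs : 0 < s)
    (e₀ : Multiset (ℕ × ℕ)) {S S' : Set (Multiset (ℕ × ℕ))}
    (hS : ∀ e ∈ S, ∀ v < s, (a, v) ::ₘ e ∈ S') : IsMarkovOn S S' (frozenStep m d s e₀ a) where
  nonneg f hf e he := Finset.sum_nonneg fun v hv =>
    mul_nonneg (weightProb_nonneg hd s e₀ v) (hf _ (hS e he v (Finset.mem_range.1 hv)))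
  one e he := by
    rw [frozenStep_apply]
    simpa using sum_weightProb hd hs e₀

theorem isMarkovOn_edgeStep (hd : -(m : ℝ) < d) {s a : ℕ} (hs : 0 < s)
    {S S' : Set (Multiset (ℕ × ℕ))}
    (hS : ∀ e ∈ S, ∀ v < s, (a, v) ::ₘ e ∈ S') : IsMarkovOn S S' (edgeStep m d s a) where
  nonneg f hf e he := (isMarkovOn_frozenStep hd hs e hS).nonneg f hf e he
  one e he := (isMarkovOn_frozenStep hd hs e hS).one e he

/-- The states at times at least `T` whose edges join vertices that are already present. -/
def statesFrom (T : ℕ) : Set (ℕ × Multiset (ℕ × ℕ)) :=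
  {x | T ≤ x.1 ∧ ∀ p ∈ x.2, p.1 ≤ x.1 ∧ p.2 ≤ x.1}

/-- The shift from `T` to `T + 1` records that time advances. It guarantees that after `a` steps
every commutator error is of order `1 / a`. -/
theorem isMarkovOn_vertexStep (hd : -(m : ℝ) < d) (T : ℕ) :
    IsMarkovOn (statesFrom T) (statesFrom (T + 1)) (vertexStep m d) := by
  have key : ∀ t, IsMarkovOn {e : Multiset (ℕ × ℕ) | ∀ p ∈ e, p.1 ≤ t + 1 ∧ p.2 ≤ t + 1}
      {e : Multiset (ℕ × ℕ) | ∀ p ∈ e, p.1 ≤ t + 1 ∧ p.2 ≤ t + 1}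
      (edgeStep m d (t + 1) (t + 1) ^ m) := fun t => by
    refine (isMarkovOn_edgeStep hd t.succ_pos ?_).pow m
    intro e he v hv p hp
    rcases Multiset.mem_cons.1 hp with rfl | hp
    · exact ⟨le_rfl, hv.le⟩
    · exact he p hp
  refine ⟨fun f hf x hx => ?_, fun x hx => ?_⟩
  · exact (key x.1).nonneg _ (fun e he => hf (x.1 + 1, e) ⟨Nat.succ_le_succ hx.1, he⟩) x.2
      fun p hp => ⟨(hx.2 p hp).1.trans x.1.le_succ, (hx.2 p hp).2.trans x.1.le_succ⟩
  · exact (key x.1).one x.2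
      fun p hp => ⟨(hx.2 p hp).1.trans x.1.le_succ, (hx.2 p hp).2.trans x.1.le_succ⟩

theorem statesFrom_anti {T T' : ℕ} (h : T ≤ T') : statesFrom T' ⊆ statesFrom T :=
  fun _ hx => ⟨h.trans hx.1, hx.2⟩

/-! ### Domination of one parameter by another -/

/-- A bound for the ratio of the weights with parameters `d` and `d'`. -/
def weightRatio (m : ℕ) (d d' : ℝ) : ℝ := 1 + |d - d'| / (m + d')

theorem weightRatio_nonneg (hd' : -(m : ℝ) < d') : 0 ≤ weightRatio m d d' :=
  add_nonneg zero_le_one (div_nonneg (abs_nonneg _) (by linarith))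

theorem weight_le (hd' : -(m : ℝ) < d') (e : Multiset (ℕ × ℕ)) (v : ℕ) :
    weight m d e v ≤ weightRatio m d d' * weight m d' e v := by
  have h0 : 0 < (m : ℝ) + d' := by linarith
  have h1 := le_weight m d' e v
  have h2 : |d - d'| ≤ |d - d'| / (m + d') * weight m d' e v := by
    rw [div_mul_eq_mul_div, le_div_iff₀ h0]
    gcongr
  have h3 : weight m d e v = weight m d' e v + (d - d') := by unfold weight; ring
  rw [h3, weightRatio, add_mul, one_mul]
  linarith [le_abs_self (d - d')]

/-- One ratio compares the numerators and the other the normalizing sums. -/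
theorem weightProb_le (hd : -(m : ℝ) < d) (hd' : -(m : ℝ) < d') {s : ℕ} (hs : 0 < s)
    (e : Multiset (ℕ × ℕ)) (v : ℕ) : weightProb m d s e v ≤
      weightRatio m d d' * weightRatio m d' d * weightProb m d' s e v := by
  have hsum : ∑ u ∈ Finset.range s, weight m d' e u ≤
      weightRatio m d' d * ∑ u ∈ Finset.range s, weight m d e u := by
    rw [Finset.mul_sum]
    exact Finset.sum_le_sum fun u _ => weight_le hd e u
  have hW := sum_weight_pos hd e hs
  have hW' := sum_weight_pos hd' e hs
  have h1 := weight_le (d := d) hd' e v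
  have hr := weightRatio_nonneg (d := d) hd'
  have hw := (weight_pos hd' e v).le
  unfold weightProb
  generalize ∑ u ∈ Finset.range s, weight m d e u = W at *
  generalize ∑ u ∈ Finset.range s, weight m d' e u = W' at *
  generalize weight m d' e v = w' at *
  generalize weight m d e v = w at *
  rw [← mul_div_assoc, div_le_div_iff₀ hW hW']
  calc w * W' ≤ (weightRatio m d d' * w') * (weightRatio m d' d * W) :=
        mul_le_mul h1 hsum hW'.le (mul_nonneg hr hw)
    _ = _ := by ring

theorem edgeStep_pow_le (hd : -(m : ℝ) < d) (hd' : -(m : ℝ) < d') {s : ℕ} (hs : 0 < s) (a k : ℕ)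
    {S : Set (Multiset (ℕ × ℕ))} (hS : ∀ e ∈ S, ∀ v < s, (a, v) ::ₘ e ∈ S)
    {f : Multiset (ℕ × ℕ) → ℝ} (hf : ∀ e ∈ S, 0 ≤ f e) : ∀ e ∈ S,
    (edgeStep m d s a ^ k) f e ≤
      (weightRatio m d d' * weightRatio m d' d) ^ k * (edgeStep m d' s a ^ k) f e := by
  have hM := isMarkovOn_edgeStep hd hs hS
  have hM' := isMarkovOn_edgeStep hd' hs hS
  set β := weightRatio m d d' * weightRatio m d' d with hβ
  have hβ0 : 0 ≤ β := mul_nonneg (weightRatio_nonneg hd') (weightRatio_nonneg hd)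
  induction k with
  | zero => intro e _; simp
  | succ k ih =>
    intro e he
    have h1 := hM.mono (g := β ^ k • (edgeStep m d' s a ^ k) f) ih he
    rw [map_smul, Pi.smul_apply, smul_eq_mul] at h1
    rw [pow_succ' (edgeStep m d s a), pow_succ' (edgeStep m d' s a)]
    refine h1.trans ?_
    have h2 : edgeStep m d s a ((edgeStep m d' s a ^ k) f) e ≤
        β * edgeStep m d' s a ((edgeStep m d' s a ^ k) f) e := by
      rw [edgeStep_apply, edgeStep_apply, Finset.mul_sum]
      refine Finset.sum_le_sum fun v hv => ?_
      rw [← mul_assoc]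
      exact mul_le_mul_of_nonneg_right (weightProb_le hd hd' hs e v)
        ((hM'.pow k).nonneg f hf _ (hS e he v (Finset.mem_range.1 hv)))
    calc _ ≤ β ^ k * (β * edgeStep m d' s a ((edgeStep m d' s a ^ k) f) e) := by gcongr
      _ = _ := by rw [pow_succ β, mul_assoc (β ^ k) β]; rfl

theorem vertexStep_le (hd : -(m : ℝ) < d) (hd' : -(m : ℝ) < d') {T : ℕ}
    {f : ℕ × Multiset (ℕ × ℕ) → ℝ} (hf : ∀ x ∈ statesFrom T, 0 ≤ f x) :
    ∀ x ∈ statesFrom T, vertexStep m d f x ≤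
      (weightRatio m d d' * weightRatio m d' d) ^ m * vertexStep m d' f x := by
  intro x hx
  refine edgeStep_pow_le (S := {e | ∀ p ∈ e, p.1 ≤ x.1 + 1 ∧ p.2 ≤ x.1 + 1}) hd hd'
    x.1.succ_pos _ _ ?_ (fun e he => hf (x.1 + 1, e) ⟨hx.1.trans x.1.le_succ, he⟩) x.2
    fun p hp => ⟨(hx.2 p hp).1.trans x.1.le_succ, (hx.2 p hp).2.trans x.1.le_succ⟩
  intro e he v hv p hp
  rcases Multiset.mem_cons.1 hp with rfl | hp
  · exact ⟨le_rfl, hv.le⟩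
  · exact he p hp

/-! ### Equivariance under relabelings -/

/-- The graph with its vertices relabeled by `σ`. -/
def relabel (σ : Equiv.Perm ℕ) (e : Multiset (ℕ × ℕ)) : Multiset (ℕ × ℕ) := e.map (Prod.map σ σ)

theorem relabel_cons (σ : Equiv.Perm ℕ) (a v : ℕ) (e : Multiset (ℕ × ℕ)) :
    relabel σ ((a, v) ::ₘ e) = (σ a, σ v) ::ₘ relabel σ e := by simp [relabel]

theorem edgeDegree_relabel (σ : Equiv.Perm ℕ) (e : Multiset (ℕ × ℕ)) (v : ℕ) :
    edgeDegree (relabel σ e) (σ v) = edgeDegree e v := by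
  have h1 : (relabel σ e).map Prod.fst = (e.map Prod.fst).map σ := by
    simp [relabel, Multiset.map_map]
  have h2 : (relabel σ e).map Prod.snd = (e.map Prod.snd).map σ := by
    simp [relabel, Multiset.map_map]
  rw [edgeDegree, h1, h2, Multiset.count_map_eq_count' _ _ σ.injective,
    Multiset.count_map_eq_count' _ _ σ.injective, edgeDegree]

theorem relabel_eq_self {σ : Equiv.Perm ℕ} {e : Multiset (ℕ × ℕ)}
    (h : ∀ p ∈ e, σ p.1 = p.1 ∧ σ p.2 = p.2) : relabel σ e = e := by
  conv_rhs => rw [← Multiset.map_id e]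
  exact Multiset.map_congr rfl fun p hp => Prod.ext (h p hp).1 (h p hp).2

theorem perm_lt_of_fix {σ : Equiv.Perm ℕ} {s : ℕ} (hσ : ∀ i, s ≤ i → σ i = i) {v : ℕ}
    (hv : v < s) : σ v < s := by
  by_contra! h
  exact absurd (σ.injective (hσ _ h)) (by omega)

theorem sum_range_perm {σ : Equiv.Perm ℕ} {s : ℕ} (hσ : ∀ i, s ≤ i → σ i = i) (g : ℕ → ℝ) :
    ∑ v ∈ Finset.range s, g (σ v) = ∑ v ∈ Finset.range s, g v := by
  refine Finset.sum_bij (fun v _ => σ v) (fun v hv => ?_) (fun _ _ _ _ h => σ.injective h)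
    (fun v hv => ?_) (fun _ _ => rfl)
  · exact Finset.mem_range.2 (perm_lt_of_fix hσ (Finset.mem_range.1 hv))
  · refine ⟨σ.symm v, Finset.mem_range.2 (perm_lt_of_fix (σ := σ.symm) (fun i hi => ?_)
      (Finset.mem_range.1 hv)), σ.apply_symm_apply v⟩
    rw [Equiv.symm_apply_eq, hσ i hi]

/-- Degrees are carried along by `σ`, and `σ` permutes the possible targets while fixing the source
`a`. -/
theorem edgeStep_relabel {σ : Equiv.Perm ℕ} {s a : ℕ} (hσ : ∀ i, s ≤ i → σ i = i) (ha : s ≤ a)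
    (f : Multiset (ℕ × ℕ) → ℝ) (e : Multiset (ℕ × ℕ)) :
    edgeStep m d s a f (relabel σ e) = edgeStep m d s a (fun e => f (relabel σ e)) e := by
  have hw : ∀ v, weight m d (relabel σ e) (σ v) = weight m d e v := fun v => by
    simp only [weight, edgeDegree_relabel]
  have hp : ∀ v, weightProb m d s (relabel σ e) (σ v) = weightProb m d s e v := fun v => by
    rw [weightProb, ← sum_range_perm hσ (weight m d (relabel σ e)), weightProb]
    simp only [hw]
  rw [edgeStep_apply, edgeStep_apply,
    ← sum_range_perm hσ (fun v => weightProb m d s (relabel σ e) v * f ((a, v) ::ₘ relabel σ e))]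
  refine Finset.sum_congr rfl fun v _ => ?_
  rw [hp, relabel_cons, hσ a ha]

theorem edgeStep_pow_relabel {σ : Equiv.Perm ℕ} {s a : ℕ} (hσ : ∀ i, s ≤ i → σ i = i) (ha : s ≤ a)
    (f : Multiset (ℕ × ℕ) → ℝ) (k : ℕ) (e : Multiset (ℕ × ℕ)) :
    (edgeStep m d s a ^ k) f (relabel σ e)
      = (edgeStep m d s a ^ k) (fun e => f (relabel σ e)) e := by
  induction k generalizing e with
  | zero => rfl
  | succ k ih =>
    simp only [pow_succ', Module.End.mul_apply]
    rw [edgeStep_relabel hσ ha]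
    simp only [ih]

/-- Functions of the unlabeled graph with values in `[0, 1]`. -/
def unlabeledFunctions : Set (ℕ × Multiset (ℕ × ℕ) → ℝ) :=
  {f | (∀ x, 0 ≤ f x ∧ f x ≤ 1) ∧ ∀ t (σ : Equiv.Perm ℕ), (∀ i, t + 1 ≤ i → σ i = i) →
    ∀ e, f (t, relabel σ e) = f (t, e)}

theorem vertexStep_mem_unlabeledFunctions (hd : -(m : ℝ) < d)
    {f : ℕ × Multiset (ℕ × ℕ) → ℝ} (hf : f ∈ unlabeledFunctions) :
    vertexStep m d f ∈ unlabeledFunctions := by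
  have hM : ∀ t, IsMarkovOn Set.univ Set.univ (edgeStep m d (t + 1) (t + 1) ^ m) := fun t =>
    (isMarkovOn_edgeStep hd t.succ_pos fun _ _ _ _ => Set.mem_univ _).pow m
  refine ⟨fun x => ⟨?_, ?_⟩, fun t σ hσ e => ?_⟩
  · exact (hM x.1).nonneg _ (fun e _ => (hf.1 _).1) _ (Set.mem_univ _)
  · exact (hM x.1).le_const (fun e _ => (hf.1 _).2) (Set.mem_univ _)
  · rw [vertexStep_apply, vertexStep_apply, edgeStep_pow_relabel hσ le_rfl]
    refine congrFun (congrArg _ (funext fun e'' => ?_)) e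
    exact hf.2 (t + 1) σ (fun i hi => hσ i (by omega)) e''

/-- Complementary to `edgeStep_relabel`: here the targets are fixed and the source may move. The
weights come from `e₀`, which is not relabeled. -/
theorem frozenStep_relabel {σ : Equiv.Perm ℕ} {s : ℕ} (hσ : ∀ v < s, σ v = v)
    (e₀ : Multiset (ℕ × ℕ)) (a : ℕ) (f : Multiset (ℕ × ℕ) → ℝ) (e : Multiset (ℕ × ℕ)) :
    frozenStep m d s e₀ (σ a) f (relabel σ e)
      = frozenStep m d s e₀ a (fun e => f (relabel σ e)) e := by
  rw [frozenStep_apply, frozenStep_apply]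
  refine Finset.sum_congr rfl fun v hv => ?_
  rw [relabel_cons, hσ v (Finset.mem_range.1 hv)]

theorem frozenStep_pow_relabel {σ : Equiv.Perm ℕ} {s : ℕ} (hσ : ∀ v < s, σ v = v)
    (e₀ : Multiset (ℕ × ℕ)) (a : ℕ) (f : Multiset (ℕ × ℕ) → ℝ) (k : ℕ) (e : Multiset (ℕ × ℕ)) :
    (frozenStep m d s e₀ (σ a) ^ k) f (relabel σ e)
      = (frozenStep m d s e₀ a ^ k) (fun e => f (relabel σ e)) e := by
  induction k generalizing e with
  | zero => rfl
  | succ k ih =>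
    simp only [pow_succ', Module.End.mul_apply]
    rw [frozenStep_relabel hσ]
    simp only [ih]

/-- Frozen weights ignore the edges just added, so the two endpoints are independent, and a multiset
forgets the order of insertion. -/
theorem commute_frozenStep (s : ℕ) (e₀ : Multiset (ℕ × ℕ)) (a b : ℕ) :
    Commute (frozenStep m d s e₀ a) (frozenStep m d' s e₀ b) := by
  refine LinearMap.ext fun f => funext fun e => ?_
  simp only [Module.End.mul_apply, frozenStep_apply, Finset.mul_sum]
  rw [Finset.sum_comm]
  refine Finset.sum_congr rfl fun v _ => Finset.sum_congr rfl fun u _ => ?_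
  rw [Multiset.cons_swap]
  ring

/-! ### Comparison with frozen weights -/

theorem edgeDegree_add (e x : Multiset (ℕ × ℕ)) (v : ℕ) :
    edgeDegree (e + x) v = edgeDegree e v + edgeDegree x v := by
  simp only [edgeDegree, Multiset.map_add, Multiset.count_add]; ring

theorem edgeDegree_cons (p : ℕ × ℕ) (e : Multiset (ℕ × ℕ)) (v : ℕ) :
    edgeDegree (p ::ₘ e) v = edgeDegree e v +
      ((if v = p.1 then 1 else 0) + if v = p.2 then 1 else 0) := by
  simp only [edgeDegree, Multiset.map_cons, Multiset.count_cons]; ring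

theorem sum_edgeDegree_le (x : Multiset (ℕ × ℕ)) (R : Finset ℕ) :
    ∑ v ∈ R, edgeDegree x v ≤ 2 * x.card := by
  induction x using Multiset.induction_on with
  | empty => simp [edgeDegree]
  | cons p x ih =>
    simp only [edgeDegree_cons, Finset.sum_add_distrib, Finset.sum_ite_eq', Multiset.card_cons]
    have h1 : (if p.1 ∈ R then 1 else 0) ≤ 1 := by split_ifs <;> simp
    have h2 : (if p.2 ∈ R then 1 else 0) ≤ 1 := by split_ifs <;> simp
    omega

theorem edgeDegree_eq_zero {e : Multiset (ℕ × ℕ)} {t v : ℕ}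
    (h : ∀ p ∈ e, p.1 ≤ t ∧ p.2 ≤ t) (hv : t < v) : edgeDegree e v = 0 := by
  have h1 : (e.map Prod.fst).count v = 0 := by
    rw [Multiset.count_eq_zero, Multiset.mem_map]
    rintro ⟨p, hp, rfl⟩
    exact absurd (h p hp).1 (by omega)
  have h2 : (e.map Prod.snd).count v = 0 := by
    rw [Multiset.count_eq_zero, Multiset.mem_map]
    rintro ⟨p, hp, rfl⟩
    exact absurd (h p hp).2 (by omega)
  rw [edgeDegree, h1, h2]

theorem abs_weight_add_sub_le (e x : Multiset (ℕ × ℕ)) (v : ℕ) :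
    |weight m d (e + x) v - weight m d e v| ≤ edgeDegree x v := by
  have h1 : max (edgeDegree e v) m ≤ max (edgeDegree (e + x) v) m := by
    rw [edgeDegree_add]; omega
  have h2 : max (edgeDegree (e + x) v) m ≤ max (edgeDegree e v) m + edgeDegree x v := by
    rw [edgeDegree_add]; omega
  have h1' : ((max (edgeDegree e v) m : ℕ) : ℝ) ≤ (max (edgeDegree (e + x) v) m : ℕ) := by
    exact_mod_cast h1
  have h2' : ((max (edgeDegree (e + x) v) m : ℕ) : ℝ) ≤
      (max (edgeDegree e v) m : ℕ) + (edgeDegree x v : ℝ) := by exact_mod_cast h2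
  unfold weight
  rw [abs_le]
  constructor <;> linarith

/-- Two weighted averages of a function with values in `[0, 1]` are close if the weights are. -/
theorem abs_sum_div_sub_sum_div_le {R : Finset ℕ} {w w' h : ℕ → ℝ} {D : ℝ}
    (hw' : ∀ v ∈ R, 0 ≤ w' v) (hW : 0 < ∑ v ∈ R, w v) (hW' : 0 < ∑ v ∈ R, w' v)
    (h0 : ∀ v ∈ R, 0 ≤ h v) (h1 : ∀ v ∈ R, h v ≤ 1) (hD : ∑ v ∈ R, |w' v - w v| ≤ D) :
    |∑ v ∈ R, w' v / (∑ u ∈ R, w' u) * h v - ∑ v ∈ R, w v / (∑ u ∈ R, w u) * h v| ≤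
      2 * D / ∑ v ∈ R, w v := by
  set W := ∑ v ∈ R, w v with hWdef
  set W' := ∑ v ∈ R, w' v with hWdef'
  have e1 : ∑ v ∈ R, w' v / W' * h v = (∑ v ∈ R, w' v * h v) / W' := by
    rw [Finset.sum_div]; exact Finset.sum_congr rfl fun v _ => by ring
  have e2 : ∑ v ∈ R, w v / W * h v = (∑ v ∈ R, w v * h v) / W := by
    rw [Finset.sum_div]; exact Finset.sum_congr rfl fun v _ => by ring
  have hA : |∑ v ∈ R, w' v * h v - ∑ v ∈ R, w v * h v| ≤ D := by
    rw [← Finset.sum_sub_distrib]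
    refine (Finset.abs_sum_le_sum_abs _ _).trans (le_trans (Finset.sum_le_sum fun v hv => ?_) hD)
    rw [← sub_mul, abs_mul, abs_of_nonneg (h0 v hv)]
    exact mul_le_of_le_one_right (abs_nonneg _) (h1 v hv)
  have hB : |W' - W| ≤ D := by
    rw [hWdef, hWdef', ← Finset.sum_sub_distrib]
    exact (Finset.abs_sum_le_sum_abs _ _).trans hD
  have hC0 : 0 ≤ ∑ v ∈ R, w' v * h v :=
    Finset.sum_nonneg fun v hv => mul_nonneg (hw' v hv) (h0 v hv)
  have hC1 : ∑ v ∈ R, w' v * h v ≤ W' :=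
    Finset.sum_le_sum fun v hv => mul_le_of_le_one_right (hw' v hv) (h1 v hv)
  rw [e1, e2]
  set P := ∑ v ∈ R, w' v * h v
  set Q := ∑ v ∈ R, w v * h v
  -- This form leaves only `W` in the outer denominator, since `P / W'` lies in `[0, 1]`; no lower
  -- bound on `W'` is needed.
  have e3 : P / W' - Q / W = ((P - Q) - P / W' * (W' - W)) / W := by field_simp; ring
  have hr : |P / W' * (W' - W)| ≤ D := by
    rw [abs_mul, abs_of_nonneg (div_nonneg hC0 hW'.le)]
    exact (mul_le_of_le_one_left (abs_nonneg _) ((div_le_one hW').2 hC1)).trans hB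
  rw [e3, abs_div, abs_of_pos hW]
  gcongr
  calc _ ≤ _ := abs_sub _ _
    _ ≤ 2 * D := by linarith

/-- The constant in the comparison of one edge with its version with frozen weights. -/
def freezeConst (m : ℕ) (d : ℝ) : ℝ := 2 * (5 * m + d) / (m + d)

theorem freezeConst_nonneg (hd : -(m : ℝ) < d) : 0 ≤ freezeConst m d :=
  div_nonneg (by have := Nat.cast_nonneg (α := ℝ) m; linarith) (by linarith)

/-- At most `2 * m` extra edges change the degrees by at most `4 * m` in total. When `s = t + 2`,
the target `t + 1`, absent from the frozen step, contributes at most `m + d` more. This gives `5 * m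
+ d`, against a total weight of at least `(t + 1) * (m + d)`. -/
theorem abs_edgeStep_sub_frozenStep_le (hd : -(m : ℝ) < d) {t s : ℕ} (a : ℕ)
    (hs : s = t + 1 ∨ s = t + 2) {e x : Multiset (ℕ × ℕ)} (he : ∀ p ∈ e, p.1 ≤ t ∧ p.2 ≤ t)
    (hx : x.card ≤ 2 * m) {h : Multiset (ℕ × ℕ) → ℝ} (h0 : ∀ y, 0 ≤ h y) (h1 : ∀ y, h y ≤ 1) :
    |edgeStep m d s a h (e + x) - frozenStep m d (t + 1) e a h (e + x)| ≤
      freezeConst m d / (t + 1) := by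
  have hpos : 0 < (m : ℝ) + d := by linarith
  set w : ℕ → ℝ := fun v => if v < t + 1 then weight m d e v else 0 with hw
  have hsub : Finset.range (t + 1) ⊆ Finset.range s := Finset.range_subset_range.2 (by omega)
  have hext : ∀ g : ℕ → ℝ, ∑ v ∈ Finset.range s, (if v < t + 1 then g v else 0) =
      ∑ v ∈ Finset.range (t + 1), g v := by
    intro g
    rw [← Finset.sum_subset hsub fun v _ hv => if_neg (by simpa using hv)]
    exact Finset.sum_congr rfl fun v hv => if_pos (Finset.mem_range.1 hv)
  have hWeq : ∑ v ∈ Finset.range s, w v = ∑ v ∈ Finset.range (t + 1), weight m d e v := hext _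
  have hfro : frozenStep m d (t + 1) e a h (e + x) = ∑ v ∈ Finset.range s,
      w v / (∑ u ∈ Finset.range s, w u) * h ((a, v) ::ₘ (e + x)) := by
    rw [hWeq, frozenStep_apply, ← hext]
    refine Finset.sum_congr rfl fun v _ => ?_
    simp only [hw, weightProb]
    split_ifs <;> simp
  have hterm : ∀ v ∈ Finset.range s, |weight m d (e + x) v - w v| ≤
      edgeDegree x v + (if v < t + 1 then 0 else m + d) := by
    intro v _
    simp only [hw]
    split_ifs with hv
    · simpa using abs_weight_add_sub_le e x v
    · rw [sub_zero, abs_of_pos (weight_pos hd _ _), weight, edgeDegree_add,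
        edgeDegree_eq_zero he (by omega), zero_add]
      have : max (edgeDegree x v) m ≤ edgeDegree x v + m := by omega
      have : ((max (edgeDegree x v) m : ℕ) : ℝ) ≤ edgeDegree x v + m := by exact_mod_cast this
      linarith
  have hextra : ∑ v ∈ Finset.range s, (if v < t + 1 then 0 else (m : ℝ) + d) ≤ m + d := by
    have h3 : ∑ v ∈ Finset.range (t + 1), (if v < t + 1 then 0 else (m : ℝ) + d) = 0 :=
      Finset.sum_eq_zero fun v hv => if_pos (Finset.mem_range.1 hv)
    rcases hs with rfl | rfl
    · rw [h3]; exact hpos.le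
    · rw [Finset.sum_range_succ, h3, zero_add, if_neg (by omega)]
  have hD : ∑ v ∈ Finset.range s, |weight m d (e + x) v - w v| ≤ 5 * m + d := by
    refine (Finset.sum_le_sum hterm).trans ?_
    rw [Finset.sum_add_distrib]
    have h4 : ∑ v ∈ Finset.range s, edgeDegree x v ≤ 4 * m :=
      (sum_edgeDegree_le x _).trans (by omega)
    have h5 : ∑ v ∈ Finset.range s, (edgeDegree x v : ℝ) ≤ 4 * m := by exact_mod_cast h4
    linarith
  have hWpos := sum_weight_pos hd e t.succ_pos
  have key := abs_sum_div_sub_sum_div_le (h := fun v => h ((a, v) ::ₘ (e + x)))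
    (fun v _ => (weight_pos hd (e + x) v).le)
    (hWeq ▸ hWpos) (sum_weight_pos hd (e + x) (by omega)) (fun v _ => h0 _) (fun v _ => h1 _) hD
  rw [hfro, edgeStep_apply]
  refine key.trans ?_
  rw [hWeq, freezeConst, div_div]
  have h6 := le_sum_weight m d e (t + 1)
  push_cast at h6
  have : 0 ≤ 2 * (5 * m + d) := by have := Nat.cast_nonneg (α := ℝ) m; linarith
  gcongr
  linarith

theorem abs_edgeStep_pow_sub_frozenStep_pow_le (hd : -(m : ℝ) < d) {t s : ℕ} (a : ℕ)
    (hs : s = t + 1 ∨ s = t + 2) {e : Multiset (ℕ × ℕ)} (he : ∀ p ∈ e, p.1 ≤ t ∧ p.2 ≤ t)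
    {N : ℕ} (hN : N ≤ 2 * m) {h h' : Multiset (ℕ × ℕ) → ℝ} (h0 : ∀ y, 0 ≤ h y) (h1 : ∀ y, h y ≤ 1)
    {η : ℝ} (hη : ∀ x, x.card ≤ N → |h (e + x) - h' (e + x)| ≤ η) (k : ℕ) :
    ∀ x, x.card + k ≤ N →
      |(edgeStep m d s a ^ k) h (e + x) - (frozenStep m d (t + 1) e a ^ k) h' (e + x)| ≤
        η + k * (freezeConst m d / (t + 1)) := by
  induction k with
  | zero => intro x hx; simpa using hη x hx
  | succ k ih =>
    intro x hx
    have hM := (isMarkovOn_edgeStep (a := a) hd (show 0 < s by omega)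
      (S := Set.univ) (S' := Set.univ) fun _ _ _ _ => Set.mem_univ _).pow k
    have h2 := abs_edgeStep_sub_frozenStep_le hd a hs he (show x.card ≤ 2 * m by omega)
      (fun y => hM.nonneg h (fun y _ => h0 y) y (Set.mem_univ _))
      (fun y => hM.le_const (fun y _ => h1 y) (Set.mem_univ y))
    have h3 := (isMarkovOn_frozenStep (a := a) hd t.succ_pos e (S := {e + x})
      (S' := {y | ∃ z, z.card + k ≤ N ∧ y = e + z}) (by
        rintro _ rfl v _
        refine ⟨(a, v) ::ₘ x, by rw [Multiset.card_cons]; omega, by rw [Multiset.add_cons]⟩)).abs_sub_le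
      (f := (edgeStep m d s a ^ k) h) (g := (frozenStep m d (t + 1) e a ^ k) h')
      (by rintro _ ⟨z, hz, rfl⟩; exact ih z hz) (Set.mem_singleton (e + x))
    rw [pow_succ', pow_succ']
    refine (abs_sub_le _ _ _).trans ((add_le_add h2 h3).trans_eq ?_)
    push_cast; ring

/-! ### Approximate commutation and the quantitative comparison. -/

/-- Two consecutive vertices with different parameters approximately commute on functions of the
unlabeled graph. -/
theorem abs_vertexStep_commutator_le (hd : -(m : ℝ) < d) (hd' : -(m : ℝ) < d') {T : ℕ}
    {f : ℕ × Multiset (ℕ × ℕ) → ℝ} (hf : f ∈ unlabeledFunctions) :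
    ∀ x ∈ statesFrom T, |vertexStep m d (vertexStep m d' f) x - vertexStep m d' (vertexStep m d f) x|
      ≤ 2 * (m * (freezeConst m d + freezeConst m d')) / (T + 1) := by
  rintro ⟨t, e⟩ ⟨htT, he⟩
  simp only at htT he
  set g : Multiset (ℕ × ℕ) → ℝ := fun e => f (t + 2, e) with hg
  -- Both vertices are frozen at the graph `e` of time `t`. The error for the second vertex, whose
  -- possible targets include `t + 1`, enters as `η` in the estimate for the first.
  have hfrozen : ∀ {b c : ℝ}, -(m : ℝ) < b → -(m : ℝ) < c →
      |vertexStep m b (vertexStep m c f) (t, e) - (frozenStep m b (t + 1) e (t + 1) ^ m)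
        ((frozenStep m c (t + 1) e (t + 2) ^ m) g) e| ≤
        m * (freezeConst m b + freezeConst m c) / (t + 1) := by
    intro b c hb hc
    have hM := (isMarkovOn_edgeStep (a := t + 2) hc (show 0 < t + 2 by omega)
      (S := Set.univ) (S' := Set.univ) fun _ _ _ _ => Set.mem_univ _).pow m
    have h1 := abs_edgeStep_pow_sub_frozenStep_pow_le hc (t + 2) (Or.inr rfl) he le_rfl
      (h := g) (h' := g) (fun y => (hf.1 _).1) (fun y => (hf.1 _).2) (η := 0)
      (fun x _ => by simp) m
    have h2 := abs_edgeStep_pow_sub_frozenStep_pow_le hb (t + 1) (Or.inl rfl) he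
      (show m ≤ 2 * m by omega) (h := (edgeStep m c (t + 2) (t + 2) ^ m) g)
      (fun y => hM.nonneg g (fun y _ => (hf.1 _).1) y (Set.mem_univ _))
      (fun y => hM.le_const (fun y _ => (hf.1 _).2) (Set.mem_univ y))
      (fun x hx => h1 x (by omega)) m 0 (by simp)
    rw [add_zero] at h2
    refine h2.trans_eq ?_
    ring
  -- Exchanging the labels `t + 1` and `t + 2` leaves `e` and `g` unchanged but exchanges the
  -- sources of the frozen steps. Commutation of these steps then restores the order.
  have hswap : (frozenStep m d' (t + 1) e (t + 1) ^ m)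
      ((frozenStep m d (t + 1) e (t + 2) ^ m) g) e =
      (frozenStep m d (t + 1) e (t + 1) ^ m) ((frozenStep m d' (t + 1) e (t + 2) ^ m) g) e := by
    set σ := Equiv.swap (t + 1) (t + 2) with hσdef
    have hσ : ∀ v < t + 1, σ v = v := fun v hv =>
      Equiv.swap_apply_of_ne_of_ne (by omega) (by omega)
    have hσ' : ∀ i, t + 2 + 1 ≤ i → σ i = i := fun v hv =>
      Equiv.swap_apply_of_ne_of_ne (by omega) (by omega)
    have hgσ : (fun e => g (relabel σ e)) = g := funext fun e => hf.2 (t + 2) σ hσ' e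
    have he' : relabel σ e = e := relabel_eq_self fun p hp =>
      ⟨hσ _ (by have := (he p hp).1; omega), hσ _ (by have := (he p hp).2; omega)⟩
    have e1 : σ (t + 2) = t + 1 := Equiv.swap_apply_right _ _
    have e2 : σ (t + 1) = t + 2 := Equiv.swap_apply_left _ _
    have h1 := frozenStep_pow_relabel (m := m) (d := d') hσ e (t + 2)
      ((frozenStep m d (t + 1) e (t + 2) ^ m) g) m e
    have h2 : (fun y => (frozenStep m d (t + 1) e (t + 2) ^ m) g (relabel σ y)) =
        (frozenStep m d (t + 1) e (t + 1) ^ m) g := by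
      funext y
      have := frozenStep_pow_relabel (m := m) (d := d) hσ e (t + 1) g m y
      rwa [hgσ, e2] at this
    rw [e1, he', h2] at h1
    rw [h1, ← Module.End.mul_apply, ← Module.End.mul_apply,
      ((commute_frozenStep (t + 1) e (t + 2) (t + 1)).pow_pow m m).eq]
  have h1 := hfrozen hd hd'
  have h2 := hfrozen hd' hd
  rw [hswap, abs_sub_comm] at h2
  have hC := mul_nonneg (Nat.cast_nonneg (α := ℝ) m)
    (add_nonneg (freezeConst_nonneg hd) (freezeConst_nonneg hd'))
  refine (abs_sub_le _ _ _).trans ((add_le_add h1 h2).trans ?_)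
  have hT : (T : ℝ) + 1 ≤ t + 1 := by exact_mod_cast Nat.succ_le_succ htT
  calc _ = 2 * (m * (freezeConst m d + freezeConst m d')) / (t + 1) := by ring
    _ ≤ _ := by gcongr

/-- The quantitative comparison: `Δ` late steps with parameter `d'` instead of `d`, seen through a
function of the unlabeled graph. -/
theorem exists_comparison_bound (m : ℕ) (hd : -(m : ℝ) < d) (hd' : -(m : ℝ) < d') :
    ∃ A C : ℝ, 0 ≤ A ∧ 0 ≤ C ∧ ∀ (a D : ℕ), ∀ f ∈ unlabeledFunctions,
      ∀ x ∈ statesFrom 1,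
      (vertexStep m d ^ (a + D * D)) ((vertexStep m d' ^ D) f) x ≤
        √(A * (vertexStep m d ^ (a + D * D + D)) f x) + C * D ^ 3 / (a + 1) := by
  set B := (weightRatio m d' d * weightRatio m d d') ^ m with hB
  have hB0 : 0 ≤ B := pow_nonneg (mul_nonneg (weightRatio_nonneg hd) (weightRatio_nonneg hd')) _
  set C := 2 * (m * (freezeConst m d' + freezeConst m d)) with hC
  have hC0 : 0 ≤ C := by
    have := freezeConst_nonneg hd
    have := freezeConst_nonneg hd'
    positivity
  refine ⟨Real.exp B, C, (Real.exp_pos _).le, hC0, fun a D f hf x hx => ?_⟩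
  set K := vertexStep m d with hK
  set K' := vertexStep m d' with hK'
  have hMark : ∀ T, IsMarkovOn (statesFrom T) (statesFrom T) K := fun T =>
    (isMarkovOn_vertexStep hd T).mono_target (statesFrom_anti T.le_succ)
  have hMark' : ∀ T, IsMarkovOn (statesFrom T) (statesFrom T) K' := fun T =>
    (isMarkovOn_vertexStep hd' T).mono_target (statesFrom_anti T.le_succ)
  have hstart : IsMarkovOn (statesFrom 1) (statesFrom (1 + a)) (K ^ a) :=
    IsMarkovOn.pow_family (fun t => isMarkovOn_vertexStep hd t) 1 a
  set S := statesFrom (1 + a) with hS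
  set ε : ℝ := C / (a + 1) with hε
  have hε0 : 0 ≤ ε := by positivity
  set g := (insertionAverage K K' D ^ D) f with hg
  -- There are `D` blocks with `D` unmodified steps each, so the window has `D * (D + 1)` steps. The
  -- first `a` steps have already brought the time to at least `1 + a`.
  have happrox : ∀ y ∈ S, |(K ^ (D * D)) ((K' ^ D) f) y - g y| ≤ D ^ 2 * D * ε := by
    intro y hy
    rw [abs_sub_comm]
    refine abs_insertionAverage_pow_sub_le (I := unlabeledFunctions) hε0 (hMark _) (hMark' _)
      (fun f hf => vertexStep_mem_unlabeledFunctions hd hf)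
      (fun f hf => vertexStep_mem_unlabeledFunctions hd' hf) (fun f hf y hy => ?_) hf D D y hy
    refine (abs_vertexStep_commutator_le hd' hd hf y hy).trans ?_
    rw [hε]
    push_cast
    gcongr
    linarith
  have hsq : ∀ y ∈ S, g y ^ 2 ≤ Real.exp B * (K ^ (D * (D + 1))) f y := by
    intro y hy
    have h1 := sq_insertionAverage_pow_le (hMark (1 + a)) (hMark' _) hB0
      (fun f hf x hx => vertexStep_le hd' hd hf x hx) f D D y hy
    have h2 : (K ^ (D * (D + 1))) (f ^ 2) y ≤ (K ^ (D * (D + 1))) f y :=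
      ((hMark (1 + a)).pow _).mono (fun z _ => by
        have := hf.1 z
        simp only [Pi.pow_apply]
        nlinarith) hy
    -- Blocks of length comparable to their number keep the product of the second-moment factors
    -- bounded.
    have h3 : (1 + B / ((D : ℝ) + 1)) ^ D ≤ Real.exp B := by
      calc (1 + B / ((D : ℝ) + 1)) ^ D ≤ Real.exp (B / (D + 1)) ^ D := by
            gcongr
            linarith [Real.add_one_le_exp (B / ((D : ℝ) + 1))]
        _ = Real.exp (D * (B / (D + 1))) := by rw [← Real.exp_nat_mul]
        _ ≤ Real.exp B := by
            gcongr
            rw [← mul_div_assoc, div_le_iff₀ (by positivity)]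
            nlinarith
    have h4 : 0 ≤ (K ^ (D * (D + 1))) f y :=
      ((hMark (1 + a)).pow _).nonneg f (fun z _ => (hf.1 z).1) y hy
    refine h1.trans ((mul_le_mul_of_nonneg_left h2 (by positivity)).trans ?_)
    gcongr
  have e1 : (K ^ (a + D * D)) ((K' ^ D) f) x = (K ^ a) ((K ^ (D * D)) ((K' ^ D) f)) x := by
    rw [pow_add]; rfl
  have e2 : (K ^ (a + D * D + D)) f x = (K ^ a) ((K ^ (D * (D + 1))) f) x := by
    rw [show a + D * D + D = a + D * (D + 1) by ring, pow_add]; rfl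
  have h5 := abs_le.1 (hstart.abs_sub_le happrox hx)
  have h6 : (K ^ a) g x ≤ √(Real.exp B * (K ^ (a + D * D + D)) f x) := by
    refine Real.le_sqrt_of_sq_le ((hstart.sq_le g hx).trans ?_)
    refine (hstart.mono (g := Real.exp B • (K ^ (D * (D + 1))) f) hsq hx).trans_eq ?_
    rw [map_smul, Pi.smul_apply, smul_eq_mul, e2]
  have h7 : (D : ℝ) ^ 2 * D * ε = C * D ^ 3 / (a + 1) := by rw [hε]; ring
  rw [e1]
  linarith [h5.2]

end PrefAttach

/-! ### Expectations under probability mass functions. -/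

namespace PMF

variable {α β : Type*}

/-- The expectation of a nonnegative function. -/
def expect (p : PMF α) (F : α → ℝ≥0∞) : ℝ≥0∞ := ∑' a, p a * F a

theorem expect_pure (a : α) (F : α → ℝ≥0∞) : (PMF.pure a).expect F = F a := by
  classical
  rw [expect, tsum_eq_single a fun b hb => by simp [PMF.pure_apply, hb]]
  simp

theorem expect_bind (p : PMF α) (q : α → PMF β) (F : β → ℝ≥0∞) :
    (p.bind q).expect F = p.expect fun a => (q a).expect F := by
  simp only [expect, PMF.bind_apply, ← ENNReal.tsum_mul_right, ← ENNReal.tsum_mul_left]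
  rw [ENNReal.tsum_comm]
  simp only [mul_assoc]

theorem expect_map (p : PMF α) (h : α → β) (F : β → ℝ≥0∞) :
    (p.map h).expect F = p.expect fun a => F (h a) := by
  rw [PMF.map, expect_bind]
  simp only [Function.comp_apply, expect_pure]

theorem expect_congr {p : PMF α} {F F' : α → ℝ≥0∞} (h : ∀ a ∈ p.support, F a = F' a) :
    p.expect F = p.expect F' := by
  refine tsum_congr fun a => ?_
  by_cases ha : a ∈ p.support
  · rw [h a ha]
  · rw [(p.apply_eq_zero_iff a).2 ha, zero_mul, zero_mul]

end PMF

/-! ### Labeled graphs as multisets of pairs of natural numbers. -/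

namespace LabeledGraph

/-- The edges of a graph on `{0, …, n - 1}` as pairs of natural numbers. -/
def toEdges {n : ℕ} (g : LabeledGraph (Fin n)) : Multiset (ℕ × ℕ) :=
  g.edges.map (Prod.map Fin.val Fin.val)

theorem toEdges_injective {n : ℕ} : Function.Injective (toEdges (n := n)) := fun _ _ h =>
  LabeledGraph.ext (Multiset.map_injective
    (Function.Injective.prodMap Fin.val_injective Fin.val_injective) h)

theorem toEdges_addEdge {n : ℕ} (g : LabeledGraph (Fin n)) (u v : Fin n) (h : u ≠ v) :
    (g.addEdge u v h).toEdges = (u.val, v.val) ::ₘ g.toEdges := by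
  simp [toEdges, addEdge]

theorem toEdges_addVertex {n : ℕ} (g : LabeledGraph (Fin n)) :
    g.addVertex.toEdges = g.toEdges := by
  simp only [toEdges, addVertex, Multiset.map_map]
  rfl

theorem degree_eq_edgeDegree {n : ℕ} (g : LabeledGraph (Fin n)) (v : Fin n) :
    g.degree v = PrefAttach.edgeDegree g.toEdges v := by
  classical
  have h1 : ∀ s : Multiset (Fin n × Fin n), ∑ u, s.count (u, v) = (s.map Prod.snd).count v := by
    intro s
    induction s using Multiset.induction_on with
    | empty => simp
    | cons p s ih =>
      simp only [Multiset.count_cons, Multiset.map_cons, Finset.sum_add_distrib, ih]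
      congr 1
      rw [Finset.sum_eq_single p.1 (fun b _ hb => if_neg fun h => hb (congrArg Prod.fst h))
        (fun h => absurd (Finset.mem_univ _) h)]
      simp [Prod.ext_iff]
  have h2 : ∀ s : Multiset (Fin n × Fin n), ∑ u, s.count (v, u) = (s.map Prod.fst).count v := by
    intro s
    induction s using Multiset.induction_on with
    | empty => simp
    | cons p s ih =>
      simp only [Multiset.count_cons, Multiset.map_cons, Finset.sum_add_distrib, ih]
      congr 1
      rw [Finset.sum_eq_single p.2 (fun b _ hb => if_neg fun h => hb (congrArg Prod.snd h))
        (fun h => absurd (Finset.mem_univ _) h)]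
      simp [Prod.ext_iff]
  have e1 : g.toEdges.map Prod.fst = (g.edges.map Prod.fst).map Fin.val := by
    simp [toEdges, Multiset.map_map]
  have e2 : g.toEdges.map Prod.snd = (g.edges.map Prod.snd).map Fin.val := by
    simp [toEdges, Multiset.map_map]
  rw [PrefAttach.edgeDegree, e1, e2, Multiset.count_map_eq_count' _ _ Fin.val_injective,
    Multiset.count_map_eq_count' _ _ Fin.val_injective, ← h1, ← h2, add_comm, degree]
  simp only [mult]
  congr!

/-- Relabeling the edges by a permutation of the vertices gives an isomorphic graph. -/
theorem exists_toEdges_eq_relabel {n : ℕ} (g : LabeledGraph (Fin n)) {σ : Equiv.Perm ℕ}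
    (hσ : ∀ i, n ≤ i → σ i = i) :
    ∃ g' : LabeledGraph (Fin n), g'.toEdges = PrefAttach.relabel σ g.toEdges ∧
      g'.toUnlabeled = g.toUnlabeled := by
  have hσ' : ∀ i, n ≤ i → σ.symm i = i := fun i hi => by rw [Equiv.symm_apply_eq, hσ i hi]
  let π : Equiv.Perm (Fin n) :=
    { toFun := fun i => ⟨σ i, PrefAttach.perm_lt_of_fix hσ i.2⟩
      invFun := fun i => ⟨σ.symm i, PrefAttach.perm_lt_of_fix hσ' i.2⟩
      left_inv := fun i => by simp
      right_inv := fun i => by simp }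
  refine ⟨⟨g.edges.map (Prod.map π π), fun e he => ?_⟩, ?_, ?_⟩
  · obtain ⟨a, ha, rfl⟩ := Multiset.mem_map.1 he
    exact fun h => g.loopless a ha (π.injective h)
  · simp only [toEdges, PrefAttach.relabel, Multiset.map_map]
    rfl
  · refine (Quotient.sound (s := isoSetoid (Fin n)) ?_).symm
    refine ⟨π, fun u v => ?_⟩
    classical
    simp only [mult]
    convert Multiset.count_map_eq_count' (Prod.map π π) g.edges
      (π.injective.prodMap π.injective) (u, v) using 2
    rfl

end LabeledGraph

/-! ### The law of the model in terms of the operators. -/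

namespace PrefAttach

open LabeledGraph

variable {m : ℕ} {d d' : ℝ}

theorem attachProb_eq {t : ℕ} {g : LabeledGraph (Fin (t + 2))}
    (hg : ∀ v < t + 1, m ≤ edgeDegree g.toEdges v) (v : Fin (t + 1)) :
    attachProb d g v = weightProb m d (t + 1) g.toEdges v := by
  have hw : ∀ v : Fin (t + 1), (g.degree v.castSucc : ℝ) + d = weight m d g.toEdges v := by
    intro v
    rw [degree_eq_edgeDegree, weight, Fin.val_castSucc, max_eq_left (hg v v.2)]
  rw [attachProb, weightProb, Finset.sum_range]
  simp only [hw]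

theorem expect_attachPMF (hd : -(m : ℝ) < d) {t : ℕ} {g : LabeledGraph (Fin (t + 2))}
    (hg : ∀ v < t + 1, m ≤ edgeDegree g.toEdges v) {h : ℕ → ℝ} (h0 : ∀ v, 0 ≤ h v) :
    (attachPMF d g).expect (fun v => ENNReal.ofReal (h v)) =
      ENNReal.ofReal (∑ v ∈ Finset.range (t + 1), weightProb m d (t + 1) g.toEdges v * h v) := by
  have hsum : ∑ v, ENNReal.ofReal (attachProb d g v) = 1 := by
    refine sum_attachProb d g fun v => ?_
    have := hg v v.2
    rw [degree_eq_edgeDegree, Fin.val_castSucc]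
    have : (m : ℝ) ≤ edgeDegree g.toEdges v := by exact_mod_cast this
    linarith
  have hn : ∀ v, 0 ≤ weightProb m d (t + 1) g.toEdges v := fun v => weightProb_nonneg hd _ _ v
  rw [PMF.expect, tsum_fintype, attachPMF, dif_pos hsum, Finset.sum_range,
    ENNReal.ofReal_sum_of_nonneg (s := Finset.univ)
      (f := fun v : Fin (t + 1) => weightProb m d (t + 1) g.toEdges v * h v)
      fun v _ => mul_nonneg (hn v) (h0 v)]
  refine Finset.sum_congr rfl fun v _ => ?_
  rw [PMF.ofFintype_apply, ← attachProb_eq hg, ← ENNReal.ofReal_mul]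
  rw [attachProb_eq hg]
  exact hn v

theorem toEdges_of_mem_support_addEdgesPMF {t : ℕ} {g : LabeledGraph (Fin (t + 2))} (k : ℕ) :
    ∀ g' ∈ (addEdgesPMF d g k).support, ∃ x : Multiset (ℕ × ℕ), g'.toEdges = g.toEdges + x ∧
      k ≤ edgeDegree x (t + 1) := by
  induction k with
  | zero =>
    intro g' hg'
    rw [addEdgesPMF, PMF.mem_support_pure_iff] at hg'
    exact ⟨0, by rw [hg', add_zero], Nat.zero_le _⟩
  | succ k ih =>
    intro g' hg'
    rw [addEdgesPMF, PMF.mem_support_bind_iff] at hg'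
    obtain ⟨g₁, hg₁, h⟩ := hg'
    obtain ⟨v, -, rfl⟩ := (PMF.mem_support_map_iff _ _ _).1 h
    obtain ⟨x, hx, hk⟩ := ih g₁ hg₁
    refine ⟨(t + 1, v.val) ::ₘ x, ?_, ?_⟩
    · rw [toEdges_addEdge, hx, Multiset.add_cons]; rfl
    · rw [edgeDegree_cons, if_pos rfl]; omega

theorem expect_addEdgesPMF (hd : -(m : ℝ) < d) {t : ℕ} {g : LabeledGraph (Fin (t + 2))}
    (hg : ∀ v < t + 1, m ≤ edgeDegree g.toEdges v) (k : ℕ) :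
    ∀ {f : Multiset (ℕ × ℕ) → ℝ}, (∀ e, 0 ≤ f e) →
    (addEdgesPMF d g k).expect (fun g' => ENNReal.ofReal (f g'.toEdges)) =
      ENNReal.ofReal ((edgeStep m d (t + 1) (t + 1) ^ k) f g.toEdges) := by
  induction k with
  | zero => intro f _; rw [addEdgesPMF, PMF.expect_pure]; rfl
  | succ k ih =>
    intro f hf
    rw [addEdgesPMF, PMF.expect_bind, pow_succ, Module.End.mul_apply, ← ih fun e =>
      (isMarkovOn_edgeStep (S := Set.univ) (S' := Set.univ) hd t.succ_pos
        fun _ _ _ _ => Set.mem_univ _).nonneg f (fun e _ => hf e) e (Set.mem_univ e)]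
    refine PMF.expect_congr fun g' hg' => ?_
    obtain ⟨x, hx, -⟩ := toEdges_of_mem_support_addEdgesPMF k g' hg'
    have hdeg : ∀ v < t + 1, m ≤ edgeDegree g'.toEdges v := fun v hv => by
      rw [hx, edgeDegree_add]; exact (hg v hv).trans (Nat.le_add_right _ _)
    rw [PMF.expect_map, edgeStep_apply,
      ← expect_attachPMF hd hdeg (h := fun v => f ((t + 1, v) ::ₘ g'.toEdges)) fun v => hf _]
    simp only [toEdges_addEdge]
    rfl

/-- Every vertex after the first two sends out `m` edges on arrival, the initial graph gives `m` to
`0` and `1`, and degrees never decrease. Hence the truncated weights are the true ones. -/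
theorem le_edgeDegree_of_mem_support_law (δ : ℕ → ℝ) (n : ℕ) :
    ∀ g ∈ (law m δ (n + 1)).support, ∀ v < n + 2, m ≤ edgeDegree g.toEdges v := by
  induction n with
  | zero =>
    intro g hg v hv
    have hg : g = initialGraph m := (PMF.mem_support_pure_iff _ _).1 hg
    rw [hg, toEdges, initialGraph, Multiset.map_replicate, edgeDegree, Multiset.map_replicate,
      Multiset.map_replicate]
    interval_cases v <;> simp
  | succ n ih =>
    intro g hg v hv
    rw [law, PMF.mem_support_bind_iff] at hg
    obtain ⟨g₀, hg₀, hg⟩ := hg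
    obtain ⟨x, hx, hm⟩ := toEdges_of_mem_support_addEdgesPMF m g hg
    rw [hx, edgeDegree_add, toEdges_addVertex]
    rcases Nat.lt_succ_iff_lt_or_eq.1 hv with h | rfl
    · exact (ih g₀ hg₀ v h).trans (Nat.le_add_right _ _)
    · exact hm.trans (Nat.le_add_left _ _)

/-- Conditioning on the graph before the last vertex moves the last step onto the test function;
iterating this gives the operator words. -/
theorem expect_law_succ {δ : ℕ → ℝ} (n : ℕ) (hd : -(m : ℝ) < δ (n + 2))
    {f : ℕ × Multiset (ℕ × ℕ) → ℝ} (hf : ∀ x, 0 ≤ f x) :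
    (law m δ (n + 2)).expect (fun g => ENNReal.ofReal (f (n + 2, g.toEdges))) =
      (law m δ (n + 1)).expect
        (fun g => ENNReal.ofReal (vertexStep m (δ (n + 2)) f (n + 1, g.toEdges))) := by
  rw [law, PMF.expect_bind]
  refine PMF.expect_congr fun g hg => ?_
  rw [expect_addEdgesPMF hd (f := fun e => f (n + 2, e))
    (by rw [toEdges_addVertex]; exact le_edgeDegree_of_mem_support_law δ n g hg) m fun e => hf _,
    toEdges_addVertex, vertexStep_apply]

/-- The initial state of the model. -/
def initialState (m : ℕ) : ℕ × Multiset (ℕ × ℕ) := (1, (initialGraph m).toEdges)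

theorem initialState_mem (m : ℕ) : initialState m ∈ statesFrom 1 := by
  refine ⟨le_rfl, fun p hp => ?_⟩
  rw [initialState, toEdges, initialGraph, Multiset.map_replicate] at hp
  rw [Multiset.eq_of_mem_replicate hp]
  exact ⟨le_rfl, Nat.zero_le _⟩

theorem expect_law_changePoint_of_le (hd : -(m : ℝ) < d) (d' : ℝ) {τ : ℕ} (n : ℕ) (hn : n + 1 ≤ τ) :
    ∀ f ∈ unlabeledFunctions,
    (law m (changePoint d d' τ) (n + 1)).expect (fun g => ENNReal.ofReal (f (n + 1, g.toEdges))) =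
      ENNReal.ofReal ((vertexStep m d ^ n) f (initialState m)) := by
  induction n with
  | zero => intro f _; exact PMF.expect_pure _ _
  | succ n ih =>
    intro f hf
    have hδ : changePoint d d' τ (n + 2) = d := if_pos hn
    rw [expect_law_succ n (by rwa [hδ]) fun x => (hf.1 x).1, hδ,
      ih (by omega) _ (vertexStep_mem_unlabeledFunctions hd hf), pow_succ]
    rfl

theorem expect_law_changePoint (hd : -(m : ℝ) < d) (hd' : -(m : ℝ) < d') (n k : ℕ) :
    ∀ f ∈ unlabeledFunctions,
    (law m (changePoint d d' (n + 1)) (n + 1 + k)).expect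
      (fun g => ENNReal.ofReal (f (n + 1 + k, g.toEdges))) =
      ENNReal.ofReal ((vertexStep m d ^ n) ((vertexStep m d' ^ k) f) (initialState m)) := by
  induction k with
  | zero => exact expect_law_changePoint_of_le hd d' n le_rfl
  | succ k ih =>
    intro f hf
    have hδ : changePoint d d' (n + 1) (n + k + 2) = d' := if_neg (by omega)
    have h := expect_law_succ (δ := changePoint d d' (n + 1)) (n + k) (by rwa [hδ]) fun x => (hf.1 x).1
    have h2 := ih _ (vertexStep_mem_unlabeledFunctions hd' hf)
    rw [pow_succ, Module.End.mul_apply, ← h2]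
    have e1 : n + 1 + (k + 1) = n + k + 2 := by ring
    have e2 : n + 1 + k = n + k + 1 := by ring
    rw [e1, e2, h, hδ]

/-- The indicator function of a set of unlabeled graphs, as a function of the edges. -/
def unlabeledIndicator {n : ℕ} (B : Set (UnlabeledGraph (Fin (n + 1)))) :
    ℕ × Multiset (ℕ × ℕ) → ℝ :=
  Set.indicator {x | x.1 = n ∧ ∃ g : LabeledGraph (Fin (n + 1)), g.toEdges = x.2 ∧
    g.toUnlabeled ∈ B} 1

/-- A relabeled graph is isomorphic to the original, and the inverse permutation gives the converse
implication. -/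
theorem unlabeledIndicator_mem {n : ℕ} (B : Set (UnlabeledGraph (Fin (n + 1)))) :
    unlabeledIndicator B ∈ unlabeledFunctions := by
  have hσ : ∀ {σ : Equiv.Perm ℕ}, (∀ i, n + 1 ≤ i → σ i = i) → ∀ {e},
      (∃ g : LabeledGraph (Fin (n + 1)), g.toEdges = e ∧ g.toUnlabeled ∈ B) →
      ∃ g : LabeledGraph (Fin (n + 1)), g.toEdges = relabel σ e ∧ g.toUnlabeled ∈ B := by
    rintro σ hσ _ ⟨g, rfl, hg⟩
    obtain ⟨g', h1, h2⟩ := exists_toEdges_eq_relabel g hσ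
    exact ⟨g', h1, h2 ▸ hg⟩
  refine ⟨fun x => ⟨?_, ?_⟩, fun t σ hfix e => ?_⟩
  · exact Set.indicator_nonneg (fun _ _ => zero_le_one) x
  · exact Set.indicator_le_self' (fun _ _ => zero_le_one) x
  · unfold unlabeledIndicator
    classical
    rw [Set.indicator_apply, Set.indicator_apply]
    refine if_congr ?_ rfl rfl
    refine and_congr_right fun ht => ?_
    simp only at ht
    subst ht
    refine ⟨fun h => ?_, hσ hfix⟩
    have := hσ (σ := σ.symm) (fun i hi => by rw [Equiv.symm_apply_eq, hfix i hi]) h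
    simpa [relabel, Multiset.map_map, Function.comp_def, Prod.map] using this

theorem toMeasure_preimage_toUnlabeled {n : ℕ} (p : PMF (LabeledGraph (Fin (n + 1))))
    (B : Set (UnlabeledGraph (Fin (n + 1)))) :
    p.toMeasure (LabeledGraph.toUnlabeled ⁻¹' B) =
      p.expect fun g => ENNReal.ofReal (unlabeledIndicator B (n, g.toEdges)) := by
  classical
  rw [PMF.toMeasure_apply _ (MeasurableSpace.measurableSet_top), PMF.expect]
  refine tsum_congr fun g => ?_
  have : ((n, g.toEdges) ∈ {x : ℕ × Multiset (ℕ × ℕ) | x.1 = n ∧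
      ∃ g : LabeledGraph (Fin (n + 1)), g.toEdges = x.2 ∧ g.toUnlabeled ∈ B}) ↔
      g ∈ LabeledGraph.toUnlabeled ⁻¹' B :=
    ⟨fun ⟨_, g', h, hB⟩ => toEdges_injective h ▸ hB, fun h => ⟨rfl, g, rfl, h⟩⟩
  rw [unlabeledIndicator, Set.indicator_apply, Set.indicator_apply, if_congr this rfl rfl]
  split_ifs <;> simp

/-- The probability of a set of unlabeled graphs under a late change-point is controlled by its
probability without change-point. -/
theorem exists_law_comparison_bound (m : ℕ) (hd : -(m : ℝ) < d) (hd' : -(m : ℝ) < d') :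
    ∃ A C : ℝ, 0 ≤ A ∧ 0 ≤ C ∧ ∀ n τ D : ℕ, τ + D = n → D * D + D < n →
      ∀ B : Set (UnlabeledGraph (Fin (n + 1))),
      ((law m (changePoint d d' τ) n).toMeasure (LabeledGraph.toUnlabeled ⁻¹' B)).toReal ≤
        √(A * ((law m (fun _ => d) n).toMeasure (LabeledGraph.toUnlabeled ⁻¹' B)).toReal) +
          C * (D ^ 3 / (n - D - D ^ 2)) := by
  obtain ⟨A, C, hA, hC, h⟩ := exists_comparison_bound m hd hd'
  refine ⟨A, C, hA, hC, fun n τ D hn hD B => ?_⟩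
  -- The chain starts at time `1`, so `a + D * D` steps lead to time `τ`.
  obtain ⟨a, rfl⟩ : ∃ a, τ = a + D * D + 1 := ⟨τ - D * D - 1, by omega⟩
  subst hn
  have hf := unlabeledIndicator_mem B
  have hconst : (fun _ : ℕ => d) = changePoint d d (a + D * D + 1) := by
    funext t; simp [changePoint]
  have hpow : (vertexStep m d ^ (a + D * D)) ((vertexStep m d ^ D) (unlabeledIndicator B))
      = (vertexStep m d ^ (a + D * D + D)) (unlabeledIndicator B) := by
    rw [pow_add _ (a + D * D) D]; rfl
  have hnn : ∀ {f}, f ∈ unlabeledFunctions → ∀ x, 0 ≤ f x := fun hf x => (hf.1 x).1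
  have hmem : ∀ {c : ℝ}, -(m : ℝ) < c → ∀ k {f}, f ∈ unlabeledFunctions →
      (vertexStep m c ^ k) f ∈ unlabeledFunctions := fun hc k _ hf =>
    pow_mem_of_invariant (fun f hf => vertexStep_mem_unlabeledFunctions hc hf) hf k
  rw [toMeasure_preimage_toUnlabeled, toMeasure_preimage_toUnlabeled, hconst,
    expect_law_changePoint hd hd' _ _ _ hf, expect_law_changePoint hd hd _ _ _ hf, hpow,
    ENNReal.toReal_ofReal (hnn (hmem hd _ (hmem hd' _ hf)) _),
    ENNReal.toReal_ofReal (hnn (hmem hd _ hf) _)]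
  refine (h a D _ hf _ (initialState_mem m)).trans_eq ?_
  congr 1
  rw [mul_div_assoc]
  congr 2
  push_cast
  ring

/-! ### Asymptotics, and passage from events to tests. -/

theorem tendsto_cube_div_of_isLittleO {u : ℕ → ℝ}
    (h : u =o[atTop] fun n : ℕ => (n : ℝ) ^ (1 / 3 : ℝ)) :
    Tendsto (fun n : ℕ => u n ^ 3 / n) atTop (𝓝 0) := by
  have h1 := h.tendsto_div_nhds_zero.pow 3
  rw [zero_pow three_ne_zero] at h1
  refine h1.congr fun n => ?_
  rw [div_pow, ← Real.rpow_natCast ((n : ℝ) ^ (1 / 3 : ℝ)), ← Real.rpow_mul n.cast_nonneg]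
  norm_num

theorem isLittleO_of_isLittleO_div_log {u : ℕ → ℝ}
    (h : u =o[atTop] fun n : ℕ => (n : ℝ) ^ (1 / 3 : ℝ) / Real.log n) :
    u =o[atTop] fun n : ℕ => (n : ℝ) ^ (1 / 3 : ℝ) := by
  refine h.trans_isBigO (IsBigO.of_bound 1 ?_)
  have hlog := (Real.tendsto_log_atTop.comp tendsto_natCast_atTop_atTop).eventually_ge_atTop 1
  filter_upwards [hlog] with n hn
  have hn : 1 ≤ Real.log n := hn
  rw [norm_div, one_mul, Real.norm_of_nonneg (by linarith : 0 ≤ Real.log n)]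
  exact div_le_self (norm_nonneg _) hn

/-- If the number of late vertices is `o(n^{1/3})`, the laws of the unlabeled graphs with a
change-point are contiguous to those without. -/
theorem tendsto_measure_of_isLittleO {m : ℕ} {d d' : ℝ} (hd : -(m : ℝ) < d) (hd' : -(m : ℝ) < d')
    {τ : ℕ → ℕ} (hτ : ∀ n, 1 ≤ n → τ n ≤ n)
    (hΔ : (fun n : ℕ => (n : ℝ) - (τ n : ℝ)) =o[atTop] fun n : ℕ => (n : ℝ) ^ (1 / 3 : ℝ))
    (B : ∀ n, Set (UnlabeledGraph (Fin (n + 1))))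
    (h : Tendsto (fun n => (law m (fun _ => d) n).toMeasure (LabeledGraph.toUnlabeled ⁻¹' B n))
      atTop (𝓝 0)) :
    Tendsto (fun n => (law m (changePoint d d' (τ n)) n).toMeasure
      (LabeledGraph.toUnlabeled ⁻¹' B n)) atTop (𝓝 0) := by
  obtain ⟨A, C, hA, hC, hbound⟩ := exists_law_comparison_bound m hd hd'
  have hcube := tendsto_cube_div_of_isLittleO hΔ
  have hlim : Tendsto (fun n : ℕ =>
      √(A * ((law m (fun _ => d) n).toMeasure (LabeledGraph.toUnlabeled ⁻¹' B n)).toReal) +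
        C * (2 * (((n : ℝ) - τ n) ^ 3 / n))) atTop (𝓝 0) := by
    have h1 : Tendsto (fun n => ((law m (fun _ => d) n).toMeasure
        (LabeledGraph.toUnlabeled ⁻¹' B n)).toReal) atTop (𝓝 0) :=
      (ENNReal.tendsto_toReal ENNReal.zero_ne_top).comp h
    have h2 := ((h1.const_mul A).sqrt).add ((hcube.const_mul 2).const_mul C)
    simpa using h2
  refine (ENNReal.tendsto_toReal_iff (fun n => measure_ne_top _ _) ENNReal.zero_ne_top).1 ?_
  refine squeeze_zero' (Eventually.of_forall fun n => ENNReal.toReal_nonneg) ?_ hlim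
  filter_upwards [eventually_ge_atTop 1, hcube.eventually_lt_const (show (0 : ℝ) < 1 / 4 by norm_num)]
    with n hn hsmall
  obtain ⟨D, hD⟩ : ∃ D, τ n + D = n := ⟨n - τ n, Nat.add_sub_cancel' (hτ n hn)⟩
  have hDr : (n : ℝ) - τ n = D := by
    rw [sub_eq_iff_eq_add']; exact_mod_cast hD.symm
  have hnpos : (0 : ℝ) < n := by exact_mod_cast hn
  rw [hDr] at hsmall ⊢
  have h3 : (D : ℝ) ^ 3 < n / 4 := by
    rw [div_lt_iff₀ hnpos] at hsmall; linarith
  -- With `D ^ 3 < n / 4`, this makes `D ^ 2 + D` less than `n / 2`, so the window fits and the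
  -- denominator of the error is at least `n / 2`.
  have h4 : D * D + D ≤ 2 * D ^ 3 := by
    rcases Nat.eq_zero_or_pos D with rfl | hpos
    · simp
    · nlinarith [Nat.mul_le_mul hpos hpos, Nat.mul_le_mul (Nat.mul_le_mul hpos hpos) hpos,
        Nat.mul_le_mul_left (D * D) hpos, Nat.mul_le_mul_left D hpos, pow_succ D 2, pow_two D]
  have h4r : (D : ℝ) * D + D ≤ 2 * (D : ℝ) ^ 3 := by exact_mod_cast h4
  have h5 : (n : ℝ) / 2 ≤ n - D - (D : ℝ) ^ 2 := by nlinarith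
  have h6 : D * D + D < n := by
    have : (D : ℝ) * D + D < n := by linarith
    exact_mod_cast this
  refine (hbound n (τ n) D hD h6 (B n)).trans ?_
  gcongr
  calc (D : ℝ) ^ 3 / (n - D - D ^ 2) ≤ (D : ℝ) ^ 3 / (n / 2) := by gcongr
    _ = 2 * ((D : ℝ) ^ 3 / n) := by field_simp

/-- Contiguity for events implies contiguity for tests. -/
theorem tendsto_integral_of_tendsto_measure {Ω : ℕ → Type*}
    {𝓕 : ∀ n, MeasurableSpace (Ω n)} [mΩ : ∀ n, MeasurableSpace (Ω n)]
    {P₀ P₁ : ∀ n, Measure (Ω n)} [∀ n, IsProbabilityMeasure (P₀ n)]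
    [∀ n, IsProbabilityMeasure (P₁ n)]
    (h𝓕 : ∀ n, 1 ≤ n → 𝓕 n ≤ mΩ n)
    (hcont : ∀ A : ∀ n, Set (Ω n), (∀ n, 1 ≤ n → MeasurableSet[𝓕 n] (A n)) →
      Tendsto (fun n => P₀ n (A n)) atTop (𝓝 0) → Tendsto (fun n => P₁ n (A n)) atTop (𝓝 0))
    {φ : ∀ n, Ω n → ℝ} (hφ : ∀ n, 1 ≤ n → Measurable[𝓕 n] (φ n))
    (h01 : ∀ n, 1 ≤ n → ∀ ω, φ n ω ∈ Set.Icc (0 : ℝ) 1)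
    (h : Tendsto (fun n => ∫ ω, φ n ω ∂(P₀ n)) atTop (𝓝 0)) :
    Tendsto (fun n => ∫ ω, φ n ω ∂(P₁ n)) atTop (𝓝 0) := by
  have hmeas : ∀ n, 1 ≤ n → Measurable (φ n) := fun n hn => (hφ n hn).mono (h𝓕 n hn) le_rfl
  have hint : ∀ (P : ∀ n, Measure (Ω n)) [∀ n, IsProbabilityMeasure (P n)] n, 1 ≤ n →
      Integrable (φ n) (P n) := fun P _ n hn =>
    Integrable.of_mem_Icc 0 1 (hmeas n hn).aemeasurable (Eventually.of_forall (h01 n hn))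
  have hset : ∀ ε n, 1 ≤ n → MeasurableSet[𝓕 n] {ω | ε ≤ φ n ω} := fun ε n hn =>
    hφ n hn measurableSet_Ici
  -- Markov's inequality is used under `P₀`; contiguity transfers the level sets of `φ` to `P₁`.
  have hmarkov : ∀ ε > 0, Tendsto (fun n => P₁ n {ω | ε ≤ φ n ω}) atTop (𝓝 0) := by
    intro ε hε
    refine hcont _ (hset ε) ?_
    refine (ENNReal.tendsto_toReal_iff (fun n => measure_ne_top _ _) ENNReal.zero_ne_top).1 ?_
    refine squeeze_zero' (Eventually.of_forall fun n => ENNReal.toReal_nonneg) ?_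
      (by simpa using h.div_const ε)
    filter_upwards [eventually_ge_atTop 1] with n hn
    rw [le_div_iff₀' hε]
    exact mul_meas_ge_le_integral_of_nonneg (Eventually.of_forall fun ω => (h01 n hn ω).1)
      (hint P₀ n hn) ε
  rw [Metric.tendsto_atTop']
  intro ε hε
  have h1 := (ENNReal.tendsto_toReal ENNReal.zero_ne_top).comp (hmarkov (ε / 2) (half_pos hε))
  have h2 := (h1.eventually_lt_const (u := ε / 2) (by simpa using half_pos hε)).and (eventually_ge_atTop 1)
  obtain ⟨N, hN⟩ := eventually_atTop.1 h2
  refine ⟨N, fun n hnN => ?_⟩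
  obtain ⟨hlt, hn⟩ := hN n hnN.le
  have hlt : (P₁ n).real {ω | ε / 2 ≤ φ n ω} < ε / 2 := hlt
  have hs : MeasurableSet {ω | ε / 2 ≤ φ n ω} := h𝓕 n hn _ (hset _ n hn)
  have hind : Integrable ({ω | ε / 2 ≤ φ n ω}.indicator (1 : Ω n → ℝ)) (P₁ n) :=
    (integrable_const (1 : ℝ)).indicator hs
  -- Since `φ ≤ 1`, it is below `ε / 2` plus the indicator of its level set.
  have hle : ∫ ω, φ n ω ∂(P₁ n) ≤
      ∫ ω, (ε / 2 + {ω | ε / 2 ≤ φ n ω}.indicator (1 : Ω n → ℝ) ω) ∂(P₁ n) := by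
    refine integral_mono (hint P₁ n hn) ((integrable_const _).add hind) fun ω => ?_
    by_cases hω : ω ∈ {ω | ε / 2 ≤ φ n ω}
    · simp only [Set.indicator_of_mem hω, Pi.one_apply]
      linarith [(h01 n hn ω).2]
    · simp only [Set.indicator_of_notMem hω, add_zero]
      exact (not_le.1 hω).le
  rw [integral_add (integrable_const _) hind, integral_indicator_one hs,
    integral_const, probReal_univ, one_smul] at hle
  rw [Real.dist_eq, sub_zero, abs_of_nonneg (integral_nonneg fun ω => (h01 n hn ω).1)]
  linarith

end PrefAttach

end

theorem mainTheorem1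
    (m : ℕ) (hm : 1 ≤ m) (δ₀ δ₁ : ℝ) (hδ₁ : -(m : ℝ) < δ₁)
    (τ : ℕ → ℕ) (hτ : ∀ n, 1 ≤ n → 1 ≤ τ n ∧ τ n ≤ n)
    (hregime :
      (0 < δ₀ ∧ (fun n : ℕ => (n : ℝ) - (τ n : ℝ)) =o[atTop] fun n : ℕ => (n : ℝ) ^ (1 / 3 : ℝ)) ∨
      (δ₀ = 0 ∧ (fun n : ℕ => (n : ℝ) - (τ n : ℝ)) =o[atTop]
        fun n : ℕ => (n : ℝ) ^ (1 / 3 : ℝ) / Real.log n))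
    (Ω : ℕ → Type*) [∀ n, MeasurableSpace (Ω n)]
    (P₀ P₁ : ∀ n, Measure (Ω n))
    [∀ n, IsProbabilityMeasure (P₀ n)] [∀ n, IsProbabilityMeasure (P₁ n)]
    (G : ∀ n, Ω n → LabeledGraph (Fin (n + 1))) (hG : ∀ n, 1 ≤ n → Measurable (G n))
    (hH₀ : ∀ n, 1 ≤ n → (P₀ n).map (G n) = (PrefAttach.law m (fun _ => δ₀) n).toMeasure)
    (hH₁ : ∀ n, 1 ≤ n → (P₁ n).map (G n) =
      (PrefAttach.law m (PrefAttach.changePoint δ₀ δ₁ (τ n)) n).toMeasure) :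
    (∀ A : ∀ n, Set (Ω n),
      (∀ n, 1 ≤ n → MeasurableSet[PrefAttach.sigmaUnlabeled (G n)] (A n)) →
      Tendsto (fun n => P₀ n (A n)) atTop (𝓝 0) → Tendsto (fun n => P₁ n (A n)) atTop (𝓝 0)) ∧
    (∀ φ : ∀ n, Ω n → ℝ,
      (∀ n, 1 ≤ n → Measurable[PrefAttach.sigmaUnlabeled (G n)] (φ n)) →
      (∀ n, 1 ≤ n → ∀ ω, φ n ω ∈ Set.Icc (0 : ℝ) 1) →
      (Tendsto (fun n => ∫ ω, φ n ω ∂(P₀ n)) atTop (𝓝 0) →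
        Tendsto (fun n => ∫ ω, φ n ω ∂(P₁ n)) atTop (𝓝 0)) ∧
      ¬ Tendsto (fun n => ∫ ω, φ n ω ∂(P₀ n) + ∫ ω, (1 - φ n ω) ∂(P₁ n)) atTop (𝓝 0)) := by
  have hm' : (1 : ℝ) ≤ m := by exact_mod_cast hm
  have hδ₀ : -(m : ℝ) < δ₀ := by
    rcases hregime with ⟨h, -⟩ | ⟨h, -⟩ <;> linarith
  have hΔ : (fun n : ℕ => (n : ℝ) - (τ n : ℝ)) =o[atTop] fun n : ℕ => (n : ℝ) ^ (1 / 3 : ℝ) := by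
    rcases hregime with ⟨-, h⟩ | ⟨-, h⟩
    · exact h
    · exact PrefAttach.isLittleO_of_isLittleO_div_log h
  have hs : ∀ n, 1 ≤ n → Measurable fun ω => (G n ω).toUnlabeled := fun n hn =>
    measurable_from_top.comp (hG n hn)
  have hcont : ∀ A : ∀ n, Set (Ω n),
      (∀ n, 1 ≤ n → MeasurableSet[PrefAttach.sigmaUnlabeled (G n)] (A n)) →
      Tendsto (fun n => P₀ n (A n)) atTop (𝓝 0) → Tendsto (fun n => P₁ n (A n)) atTop (𝓝 0) := by
    intro A hA h
    choose! B _ hB using hA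
    have hlaw : ∀ (P : ∀ n, Measure (Ω n)) (p : ∀ n, PMF (LabeledGraph (Fin (n + 1)))),
        (∀ n, 1 ≤ n → (P n).map (G n) = (p n).toMeasure) →
        (fun n => (p n).toMeasure (LabeledGraph.toUnlabeled ⁻¹' B n))
          =ᶠ[atTop] fun n => P n (A n) := by
      intro P p hP
      filter_upwards [eventually_ge_atTop 1] with n hn
      rw [← hP n hn, Measure.map_apply (hG n hn) MeasurableSpace.measurableSet_top, ← hB n hn]
      rfl
    exact (PrefAttach.tendsto_measure_of_isLittleO hδ₀ hδ₁ (fun n hn => (hτ n hn).2) hΔ B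
      (h.congr' (hlaw P₀ _ hH₀).symm)).congr' (hlaw P₁ _ hH₁)
  refine ⟨hcont, fun φ hφ h01 => ?_⟩
  have htest : Tendsto (fun n => ∫ ω, φ n ω ∂(P₀ n)) atTop (𝓝 0) →
      Tendsto (fun n => ∫ ω, φ n ω ∂(P₁ n)) atTop (𝓝 0) :=
    PrefAttach.tendsto_integral_of_tendsto_measure (fun n hn => (hs n hn).comap_le) hcont hφ h01
  refine ⟨htest, fun hsum => ?_⟩
  have hnn₀ : ∀ n, 1 ≤ n → 0 ≤ ∫ ω, φ n ω ∂(P₀ n) := fun n hn =>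
    integral_nonneg fun ω => (h01 n hn ω).1
  have hnn₁ : ∀ n, 1 ≤ n → 0 ≤ ∫ ω, (1 - φ n ω) ∂(P₁ n) := fun n hn =>
    integral_nonneg fun ω => sub_nonneg.2 (h01 n hn ω).2
  have h₀ : Tendsto (fun n => ∫ ω, φ n ω ∂(P₀ n)) atTop (𝓝 0) := by
    refine squeeze_zero' ?_ ?_ hsum <;> filter_upwards [eventually_ge_atTop 1] with n hn
    · exact hnn₀ n hn
    · exact le_add_of_nonneg_right (hnn₁ n hn)
  -- The type I error tends to zero, hence so does the power, while type II error plus power equals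
  -- `1`.
  have h₁ := (hsum.sub h₀).add (htest h₀)
  rw [sub_zero, add_zero] at h₁
  refine one_ne_zero (tendsto_nhds_unique (tendsto_const_nhds.congr' ?_) h₁)
  filter_upwards [eventually_ge_atTop 1] with n hn
  have hint : Integrable (φ n) (P₁ n) := Integrable.of_mem_Icc 0 1
    ((hφ n hn).mono (hs n hn).comap_le le_rfl).aemeasurable (Eventually.of_forall (h01 n hn))
  rw [integral_sub (integrable_const _) hint, integral_const, probReal_univ, one_smul]
  ring
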